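/- **Theorem (reduction of order).** Let $n\ge 1$. Write $(x,y,y_1,\dots,y_n)$ for the coordinates of the jet space $J^n=\mathbb R^{n+2}$. Let $\mathsf E$ be a smooth real function on an open set $\Omega\subseteq J^n$ with $\partial \mathsf E/\partial y_n\neq 0$ wherever $\mathsf E=0$. A *solution* of $\mathsf E=0$ is a $C^n$ function $f$ on a nonempty open interval $I$ whose jets $(x,f(x),\dots,f^{(n)}(x))$, $x\in I$, lie in $\Omega$ and satisfy $\mathsf E=0$. Let $G=\{\Phi_\varepsilon\}$ be a smooth local one-parameter group of transformations of an open set $M\subseteq\mathbb R^2$ that contains the points $(x,y)$ of all jets in $\Omega$, and let $\mathbf v=\frac{d}{d\varepsilon}\big|_{\varepsilon=0}\Phi_\varepsilon$ be its generator. Assume that $G$ is a symmetry group of the equation: if $f$ is a solution on $I$ and $x_0\in I$, then there is an open interval $I'\ni x_0$ in $I$ such that for all sufficiently small $\varepsilon$ the map $\Phi_\varepsilon$ is defined on the graph of $f|_{I'}$ and takes it to the graph of a solution. Then: 1. Near every point of $M$ where $\mathbf v\ne 0$ there are rectifying coordinates $(r,s)$, that is, smooth local coordinates with $\mathbf v(r)=0$,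 $\mathbf v(s)=1$ (so $\mathbf v=\partial_s$). 2. Let $(r,s)$ be any rectifying coordinates on an open set $U\subseteq M$. For a jet over $U$ that is transverse to $\mathbf v$ (i.e. $\mathbf v$ is not a multiple of $(1,y_1)$) let $z_i=d^{\,i+1}s/dr^{\,i+1}$ $(0\le i\le n-1)$ be defined by $\frac{d^0s}{dr^0}=s$, $\frac{d^{k+1}s}{dr^{k+1}}=\frac{D_x(d^ks/dr^k)}{D_xr}$, where $D_x$ is the total derivative. Call a pair $(D,J)$, with $D\subseteq\mathbb R^{n+1}$ open and $J\subseteq\mathbb R$ a nonempty open interval, a *reduction domain* if every $(r,s,z_0,\dots,z_{n-1})$ with $(r,z_0,\dots,z_{n-1})\in D$ and $s\in J$ comes from a jet in $\Omega$ over $U$ transverse to $\mathbf v$. Every jet in $\Omega$ over $U$ transverse to $\mathbf v$ has its coordinates in some reduction domain. 3. For every reduction domain $(D,J)$ there is a reduced equation $R(r,z_0,\dots,z_{n-1})=0$ of order $n-1$ for $z=z(r)$, with $R$ smooth on $D$ and $\partial R/\partial z_{n-1}\ne0$ wherever $R=0$, such that: - (a) a jet in $\Omega$ over $U$, transverse to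 $\mathbf v$, with $(r,z_0,\dots,z_{n-1})\in D$ and $s\in J$, satisfies $\mathsf E=0$ if and only if $R(r,z_0,\dots,z_{n-1})=0$; so in the coordinates $(r,s)$ the equation does not involve $s$; - (b) if $f$ is a solution of $\mathsf E=0$ on $I$ with graph in $U$ to which $\mathbf v$ is nowhere tangent, then $\rho(x)=r(x,f(x))$ is injective on $I$ and there is a $C^{n-1}$ function $\vartheta$ on $\rho(I)$ such that $(\rho(x),\vartheta(\rho(x)),\dots,\vartheta^{(n-1)}(\rho(x)))$ is the tuple $(r,z_0,\dots,z_{n-1})$ of the jet of $f$ at $x$; $\vartheta$ is a solution of $R=0$ on $\rho(I')$ for every nonempty open interval $I'\subseteq I$ over which the jets of $f$ have $(r,z_0,\dots,z_{n-1})\in D$ and $s\in J$; and, for each $x_1\in I$, the graph of $f$ is recovered by one quadrature: in the coordinates $(r,s)$ it is the curve $s=s(x_1,f(x_1))+\int_{\rho(x_1)}^{r}\vartheta(t)\,dt$, $r\in\rho(I)$; - (c) conversely, if $\vartheta$ is a solution of $R=0$ on an open interval $K$, $r_1\in K$, $c\in\mathbb R$, and $\sigma(r)=c+\int_{r_1}^r\vartheta(t)\,dt$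 has values in $J$ on $K$, then the curve $s=\sigma(r)$, $r\in K$, lies in the image of the coordinates $(r,s)$ and is, in the coordinates $(x,y)$, the graph of a solution of $\mathsf E=0$ to which $\mathbf v$ is nowhere tangent. (For $n=1$ the reduced equation is an equation $R(r,z)=0$ without derivatives.) -/

import Mathlib

open Set Filter Topology
open scoped ContDiff

namespace ODEReduction

/-- The jet space `J^k` of one independent and one dependent variable: the point
`(x, (y, y₁, …, y_k))` is encoded as `q` with `q.1 = x` and `q.2 i = y_i`, `y_0 = y`. -/
abbrev Jet (k : ℕ) : Type := ℝ × (Fin (k + 1) → ℝ)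

/-- The underlying point `(x, y)` of the plane. -/
def Jet.base {k : ℕ} (q : Jet k) : ℝ × ℝ := (q.1, q.2 0)

/-- The projection `J^m → J^k`, `k ≤ m`, forgetting the derivatives of order `> k`. -/
def Jet.restrict {m k : ℕ} (q : Jet m) (h : k + 1 ≤ m + 1) : Jet k :=
  (q.1, fun i => q.2 (Fin.castLE h i))

/-- The `k`-jet `(x, f(x), f'(x), …, f^{(k)}(x))` of a function. -/
noncomputable def jet (k : ℕ) (f : ℝ → ℝ) (x : ℝ) : Jet k :=
  (x, fun i => iteratedDeriv (i : ℕ) f x)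

/-- The total derivative `D_x F = F_x + ∑_{i ≤ k} y_{i+1} F_{y_i}`, a function on `J^{k+1}`,
of a differential function `F` on `J^k`. -/
noncomputable def totalDeriv {k : ℕ} (F : Jet k → ℝ) (q : Jet (k + 1)) : ℝ :=
  fderiv ℝ F (q.restrict (Nat.le_succ _)) (1, fun i => q.2 i.succ)

/-- `E = 0` is a scalar ordinary differential equation of order `k`: `E` is smooth on the open
subset `Ω` of `J^k`, and `∂E/∂y_k ≠ 0` at the points satisfying the equation.
For `k = 0` this is a (regular) equation `E(x, y) = 0` without derivatives. -/
structure IsODE (k : ℕ) (Ω : Set (Jet k)) (E : Jet k → ℝ) : Prop where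
  isOpen : IsOpen Ω
  smooth : ContDiffOn ℝ ∞ E Ω
  regular : ∀ q ∈ Ω, E q = 0 → fderiv ℝ E q (0, Pi.single (Fin.last k) 1) ≠ 0

/-- `f` is a (classical) solution of the equation `E = 0` of order `k` on the open interval `I`
(possibly unbounded). -/
structure IsSolution (k : ℕ) (Ω : Set (Jet k)) (E : Jet k → ℝ) (I : Set ℝ) (f : ℝ → ℝ) :
    Prop where
  isOpen : IsOpen I
  isConnected : IsConnected I
  contDiffOn : ContDiffOn ℝ k f I
  mem : ∀ x ∈ I, jet k f x ∈ Ω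
  eq_zero : ∀ x ∈ I, E (jet k f x) = 0

/-- A smooth local one-parameter group of transformations `Φ_ε` of the open subset `M` of the
plane; `dom` is the set of the pairs `(ε, p)` for which `Φ_ε(p)` is defined. -/
structure IsLocalOneParameterGroup (M : Set (ℝ × ℝ)) (dom : Set (ℝ × (ℝ × ℝ)))
    (Φ : ℝ → ℝ × ℝ → ℝ × ℝ) : Prop where
  isOpen_space : IsOpen M
  isOpen_dom : IsOpen dom
  mem_space : ∀ ε p, (ε, p) ∈ dom → p ∈ M
  zero_mem : ∀ p ∈ M, ((0 : ℝ), p) ∈ dom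
  interval : ∀ p ∈ M, {ε : ℝ | (ε, p) ∈ dom}.OrdConnected
  smooth : ContDiffOn ℝ ∞ (fun z : ℝ × (ℝ × ℝ) => Φ z.1 z.2) dom
  mapsTo : ∀ ε p, (ε, p) ∈ dom → Φ ε p ∈ M
  map_zero : ∀ p ∈ M, Φ 0 p = p
  map_add : ∀ δ ε p, (ε, p) ∈ dom → (δ, Φ ε p) ∈ dom → (δ + ε, p) ∈ dom →
    Φ δ (Φ ε p) = Φ (δ + ε) p
  map_neg : ∀ ε p, (ε, p) ∈ dom → (-ε, Φ ε p) ∈ dom ∧ Φ (-ε) (Φ ε p) = p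

/-- `v` is the infinitesimal generator of the local one-parameter group `Φ` of `M`. -/
def IsGenerator (M : Set (ℝ × ℝ)) (Φ : ℝ → ℝ × ℝ → ℝ × ℝ) (v : ℝ × ℝ → ℝ × ℝ) : Prop :=
  ∀ p ∈ M, HasDerivAt (fun ε => Φ ε p) (v p) 0

/-- The local one-parameter group `Φ` is a symmetry group of the equation `E = 0` of order `k`:
it maps solutions to solutions, acting on functions through their graphs. As the group is local,
this is only asked, for a solution `f` near any point of its interval `I`, for the group
parameters `ε` that are small enough (depending on `f` and on the point). -/
def IsSymmetryGroup (k : ℕ) (Ω : Set (Jet k)) (E : Jet k → ℝ) (dom : Set (ℝ × (ℝ × ℝ)))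
    (Φ : ℝ → ℝ × ℝ → ℝ × ℝ) : Prop :=
  ∀ (I : Set ℝ) (f : ℝ → ℝ), IsSolution k Ω E I f → ∀ x₀ ∈ I,
    ∃ I' ⊆ I, IsOpen I' ∧ IsConnected I' ∧ x₀ ∈ I' ∧
      ∀ᶠ ε in 𝓝 (0 : ℝ), (∀ p ∈ graphOn f I', (ε, p) ∈ dom) ∧
        ∃ (I₁ : Set ℝ) (f₁ : ℝ → ℝ),
          graphOn f₁ I₁ = Φ ε '' graphOn f I' ∧ IsSolution k Ω E I₁ f₁

/-- `v` is nowhere tangent to the graph of `f` over `I`. -/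
def NowhereTangent (v : ℝ × ℝ → ℝ × ℝ) (I : Set ℝ) (f : ℝ → ℝ) : Prop :=
  ∀ x ∈ I, ∀ c : ℝ, v (x, f x) ≠ c • ((1 : ℝ), deriv f x)

/-- `v` is not tangent to the graphs through the jet `q`, whose tangent there is `(1, y₁)`. -/
def Transverse {n : ℕ} (v : ℝ × ℝ → ℝ × ℝ) (q : Jet (n + 1)) : Prop :=
  ∀ c : ℝ, v q.base ≠ c • ((1 : ℝ), q.2 1)

/-- `φ = (r, s)` are rectifying coordinates for `v` on the open set `φ.source ⊆ M`: a smooth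
change of coordinates, with smooth inverse, such that `v(r) = 0` and `v(s) = 1`,
i.e. `v = ∂_s`. -/
structure IsRectifyingChart (M : Set (ℝ × ℝ)) (v : ℝ × ℝ → ℝ × ℝ)
    (φ : OpenPartialHomeomorph (ℝ × ℝ) (ℝ × ℝ)) : Prop where
  source_subset : φ.source ⊆ M
  smooth : ContDiffOn ℝ ∞ φ φ.source
  smooth_symm : ContDiffOn ℝ ∞ φ.symm φ.target
  rectifies : ∀ p ∈ φ.source, fderiv ℝ φ p (v p) = (0, 1)

/-- The derivative `d^k s / dr^k` in the coordinates `φ = (r, s)`, as a function on `J^k`: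
`d^0 s / dr^0 = s(x, y)` and `d^{k+1} s / dr^{k+1} = D_x (d^k s / dr^k) / D_x r`. -/
noncomputable def sDeriv (φ : ℝ × ℝ → ℝ × ℝ) : (k : ℕ) → Jet k → ℝ
  | 0, q => (φ q.base).2
  | k + 1, q => totalDeriv (sDeriv φ k) q /
      totalDeriv (fun p : Jet 0 => (φ p.base).1) (q.restrict (by omega) : Jet 1)

/-- For a jet `q` of order `n + 1`, the jet `(r, (z, z₁, …, z_n))` of order `n`, where
`z = ds/dr` and `z_i = d^i z / dr^i = d^{i+1} s / dr^{i+1}`. -/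
noncomputable def reducedJet {n : ℕ} (φ : ℝ × ℝ → ℝ × ℝ) (q : Jet (n + 1)) : Jet n :=
  ((φ q.base).1, fun i => sDeriv φ (i + 1) (q.restrict (by omega)))

/-- The open set `D` of jets `w = (r, (z, z₁, …, z_n))` and the open interval `J` of values of
`s` are such that all `(r, s, z, …, z_n)` with `w ∈ D` and `s ∈ J` are the `(r, s)`-coordinates
of a jet that belongs to the domain `Ω` of the equation and is transverse to `v`. -/
structure IsReductionDomain {n : ℕ} (Ω : Set (Jet (n + 1))) (v : ℝ × ℝ → ℝ × ℝ)
    (φ : OpenPartialHomeomorph (ℝ × ℝ) (ℝ × ℝ)) (D : Set (Jet n)) (J : Set ℝ) : Prop where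
  isOpen : IsOpen D
  isOpen_interval : IsOpen J
  isConnected : IsConnected J
  exists_jet : ∀ w ∈ D, ∀ s ∈ J, ∃ q ∈ Ω, q.base ∈ φ.source ∧ Transverse v q ∧
    (φ q.base).2 = s ∧ reducedJet φ q = w

end ODEReduction

open ODEReduction

namespace ODEReduction

/-! ### Jets of functions -/

/-! In rectifying coordinates `v` is `∂_s`, so the group acts by the translations `s ↦ s + ε`. These
fix `r` and all derivatives of `s` with respect to `r`, so an invariant equation in these
coordinates cannot depend on `s`. It is therefore an equation of one order less for `z = ds/dr`, and
`s` is recovered by integrating `z`. The order of the given equation is written `n + 1` and that of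
the reduced one `n`.

Two points need care. First, the coordinates must be carried to jets. The prolongation of `φ` is
computed on graphs by the chain rule (`prolong_jet_eq`). Since every jet is the jet of a function,
the prolongations of `φ` and `φ.symm` are mutually inverse on the jets with `D_x r ≠ 0` and on their
images (`prolong_symm_prolong`). For a rectifying chart these are exactly the transverse jets.

Second, the symmetry hypothesis concerns solutions, not the function `E`, so only the zero set of
`E` can be invariant. Regularity puts a solution through every jet with `E = 0`
(`exists_isSolution`). Moving it by the group shows that the zero set is preserved by small
translations of `s` (`IsSymmetryGroup.eventually_translate`). For fixed `w ∈ D`, the `s ∈ J` giving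
zeros thus form a set that is open and closed in `J`, hence empty or all of `J`
(`IsReductionDomain.eq_zero_of_eq_zero`).

One may therefore freeze `s` at any value in `J` to define `R`. It is regular because prolongation
multiplies the direction of the top derivative by a nonzero factor (`fderiv_prolong_topDirection`).
-/

theorem exists_contDiff_jet_eq {k : ℕ} (q : Jet k) :
    ∃ f : ℝ → ℝ, ContDiff ℝ ∞ f ∧ jet k f q.1 = q := by
  -- The Taylor polynomial with the prescribed derivatives.
  refine ⟨fun t => ∑ i : Fin (k + 1), (q.2 i / (i : ℕ).factorial) * (t - q.1) ^ (i : ℕ),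
    by fun_prop, Prod.ext rfl (funext fun j => ?_)⟩
  simp only [jet]
  rw [iteratedDeriv_fun_sum fun i _ => by fun_prop]
  have h : ∀ i : Fin (k + 1), iteratedDeriv (j : ℕ)
      (fun t : ℝ => (q.2 i / (i : ℕ).factorial) * (t - q.1) ^ (i : ℕ)) q.1 =
      if i = j then q.2 j else 0 := by
    intro i
    rw [iteratedDeriv_const_mul_field,
      iteratedDeriv_comp_sub_const (f := fun t : ℝ => t ^ (i : ℕ))]
    simp only [sub_self]
    rw [iteratedDeriv_fun_pow_zero]
    by_cases hij : i = j
    · subst hij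
      simp [Nat.factorial_ne_zero]
    · rw [if_neg fun h => hij (Fin.ext h.symm), if_neg hij, Nat.cast_zero, mul_zero]
  simp [h]

theorem differentiableAt_iteratedDeriv {k : ℕ} {f : ℝ → ℝ} {x : ℝ}
    (hf : ContDiffAt ℝ (k + 1 : ℕ) f x) {i : ℕ} (hi : i ≤ k) :
    DifferentiableAt ℝ (iteratedDeriv i f) x := by
  have h := hf.contDiffWithinAt (s := univ)
    |>.differentiableWithinAt_iteratedDerivWithin (m := i)
      (by exact_mod_cast Nat.lt_succ_of_le hi) (by simp)
  simpa [iteratedDerivWithin_univ, differentiableWithinAt_univ] using h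

theorem hasDerivAt_jet {k : ℕ} {f : ℝ → ℝ} {x : ℝ} (hf : ContDiffAt ℝ (k + 1 : ℕ) f x) :
    HasDerivAt (jet k f) (1, fun i : Fin (k + 1) => (jet (k + 1) f x).2 i.succ) x := by
  refine (hasDerivAt_id x).prodMk (hasDerivAt_pi.2 fun i => ?_)
  have h := (differentiableAt_iteratedDeriv hf (Nat.le_of_lt_succ i.2)).hasDerivAt
  rwa [← iteratedDeriv_succ] at h

theorem hasDerivAt_comp_jet {k : ℕ} {f : ℝ → ℝ} {x : ℝ} (hf : ContDiffAt ℝ (k + 1 : ℕ) f x)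
    {F : Jet k → ℝ} (hF : DifferentiableAt ℝ F (jet k f x)) :
    HasDerivAt (fun t => F (jet k f t)) (totalDeriv F (jet (k + 1) f x)) x :=
  hF.hasFDerivAt.comp_hasDerivAt x (hasDerivAt_jet hf)

theorem continuousAt_jet {k : ℕ} {f : ℝ → ℝ} {I : Set ℝ} (hI : IsOpen I)
    (hf : ContDiffOn ℝ k f I) {x : ℝ} (hx : x ∈ I) : ContinuousAt (jet k f) x := by
  refine continuousAt_id.prodMk (continuousAt_pi.2 fun i => ?_)
  have h := hf.continuousOn_iteratedDerivWithin (m := i)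
    (by exact_mod_cast Nat.le_of_lt_succ i.2) hI.uniqueDiffOn
  exact (h.congr fun y hy => (iteratedDerivWithin_of_isOpen hI hy).symm).continuousAt
    (hI.mem_nhds hx)

@[fun_prop]
theorem contDiff_restrict {m k : ℕ} (h : k + 1 ≤ m + 1) :
    ContDiff ℝ ∞ (fun q : Jet m => q.restrict h) := by
  unfold Jet.restrict
  fun_prop

@[fun_prop]
theorem contDiff_base {k : ℕ} : ContDiff ℝ ∞ (fun q : Jet k => q.base) := by
  unfold Jet.base
  fun_prop

/-! ### Prolongation of a change of coordinates -/

/-- The derivative `D_x r` along a jet. -/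
noncomputable def slope {k : ℕ} (φ : ℝ × ℝ → ℝ × ℝ) (q : Jet (k + 1)) : ℝ :=
  (fderiv ℝ φ q.base (1, q.2 1)).1

/-- The jets over the source of `φ = (r, s)` along which `D_x r` does not vanish. -/
def regularJets (φ : OpenPartialHomeomorph (ℝ × ℝ) (ℝ × ℝ)) (k : ℕ) : Set (Jet (k + 1)) :=
  {q | q.base ∈ φ.source ∧ slope φ q ≠ 0}

/-- The prolongation of `φ = (r, s)` to jets: `(r, (s, ds/dr, …, d^k s/dr^k))`. -/
noncomputable def prolong {k : ℕ} (φ : ℝ × ℝ → ℝ × ℝ) (q : Jet k) : Jet k :=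
  ((φ q.base).1, fun i => sDeriv φ i (q.restrict (Nat.succ_le_of_lt i.2)))

theorem totalDeriv_fst_comp_base {φ : ℝ × ℝ → ℝ × ℝ} {k : ℕ} {q : Jet (k + 1)}
    (hφ : DifferentiableAt ℝ φ q.base) :
    totalDeriv (fun p : Jet 0 => (φ p.base).1) (q.restrict (by omega) : Jet 1) = slope φ q := by
  have h1 : HasFDerivAt (fun p : Jet 0 => p.base)
      ((ContinuousLinearMap.fst ℝ ℝ (Fin 1 → ℝ)).prod
        ((ContinuousLinearMap.proj (0 : Fin 1)).comp (ContinuousLinearMap.snd ℝ ℝ (Fin 1 → ℝ))))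
      ((q.restrict (by omega) : Jet 1).restrict (Nat.le_succ _)) :=
    ((ContinuousLinearMap.fst ℝ ℝ (Fin 1 → ℝ)).prod
        ((ContinuousLinearMap.proj (0 : Fin 1)).comp
          (ContinuousLinearMap.snd ℝ ℝ (Fin 1 → ℝ)))).hasFDerivAt
  have h2 : HasFDerivAt φ (fderiv ℝ φ q.base)
      (((q.restrict (by omega) : Jet 1).restrict (Nat.le_succ _) : Jet 0).base) :=
    hφ.hasFDerivAt
  have h3 := (h2.comp _ h1).fst.fderiv
  unfold totalDeriv slope
  simp only [Function.comp_def] at h3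
  rw [h3]
  rfl

theorem contDiffAt_totalDeriv {k : ℕ} {F : Jet k → ℝ} {q : Jet (k + 1)}
    (hF : ContDiffAt ℝ ∞ F (q.restrict (Nat.le_succ _))) :
    ContDiffAt ℝ ∞ (totalDeriv F) q := by
  unfold totalDeriv
  have h : ContDiffAt ℝ ∞ (fderiv ℝ F) (q.restrict (Nat.le_succ _)) :=
    hF.fderiv_right (by simp)
  exact (ContDiffAt.comp q h (contDiff_restrict _).contDiffAt).clm_apply (by fun_prop)

theorem contDiffAt_slope {φ : ℝ × ℝ → ℝ × ℝ} {k : ℕ} {q : Jet (k + 1)}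
    (hφ : ContDiffAt ℝ ∞ φ q.base) : ContDiffAt ℝ ∞ (slope φ) q := by
  unfold slope
  have h : ContDiffAt ℝ ∞ (fderiv ℝ φ) q.base := hφ.fderiv_right (by simp)
  exact ((ContDiffAt.comp q h contDiff_base.contDiffAt).clm_apply (by fun_prop)).fst

theorem contDiffAt_chart {φ : OpenPartialHomeomorph (ℝ × ℝ) (ℝ × ℝ)}
    (hφ : ContDiffOn ℝ ∞ φ φ.source) {p : ℝ × ℝ} (hp : p ∈ φ.source) : ContDiffAt ℝ ∞ φ p :=
  hφ.contDiffAt (φ.open_source.mem_nhds hp)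

theorem differentiableAt_chart {φ : OpenPartialHomeomorph (ℝ × ℝ) (ℝ × ℝ)}
    (hφ : ContDiffOn ℝ ∞ φ φ.source) {p : ℝ × ℝ} (hp : p ∈ φ.source) : DifferentiableAt ℝ φ p :=
  (contDiffAt_chart hφ hp).differentiableAt (by simp)

theorem fderiv_symm_fderiv {φ : OpenPartialHomeomorph (ℝ × ℝ) (ℝ × ℝ)}
    (hφ : ContDiffOn ℝ ∞ φ φ.source) (hφ' : ContDiffOn ℝ ∞ φ.symm φ.target)
    {p : ℝ × ℝ} (hp : p ∈ φ.source) (u : ℝ × ℝ) :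
    fderiv ℝ φ.symm (φ p) (fderiv ℝ φ p u) = u := by
  have h1 := (differentiableAt_chart hφ hp).hasFDerivAt
  have h2 := (differentiableAt_chart (φ := φ.symm) hφ' (φ.map_source hp)).hasFDerivAt
  have h3 := h2.comp p h1
  have h4 : HasFDerivAt (φ.symm ∘ φ) (ContinuousLinearMap.id ℝ (ℝ × ℝ)) p :=
    (hasFDerivAt_id p).congr_of_eventuallyEq
      (Filter.eventually_of_mem (φ.open_source.mem_nhds hp) fun _ hx => φ.left_inv hx)
  exact congrArg (fun L : ℝ × ℝ →L[ℝ] ℝ × ℝ => L u) (h3.unique h4)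

theorem isOpen_regularJets {φ : OpenPartialHomeomorph (ℝ × ℝ) (ℝ × ℝ)}
    (hφ : ContDiffOn ℝ ∞ φ φ.source) (k : ℕ) : IsOpen (regularJets φ k) := by
  rw [isOpen_iff_mem_nhds]
  intro q hq
  exact (contDiff_base.continuous.continuousAt.eventually (φ.open_source.mem_nhds hq.1)).and
    ((contDiffAt_slope (contDiffAt_chart hφ hq.1)).continuousAt.eventually_ne hq.2)

theorem contDiffAt_sDeriv_zero {φ : OpenPartialHomeomorph (ℝ × ℝ) (ℝ × ℝ)}
    (hφ : ContDiffOn ℝ ∞ φ φ.source) {q : Jet 0} (hq : q.base ∈ φ.source) :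
    ContDiffAt ℝ ∞ (sDeriv φ 0) q :=
  (ContDiffAt.comp q (contDiffAt_chart hφ hq) contDiff_base.contDiffAt).snd

/-- The recursion only ever divides by `D_x r`, so its nonvanishing is all that smoothness needs. -/
theorem contDiffAt_sDeriv_succ {φ : OpenPartialHomeomorph (ℝ × ℝ) (ℝ × ℝ)}
    (hφ : ContDiffOn ℝ ∞ φ φ.source) {k : ℕ} {q : Jet (k + 1)} (hq : q ∈ regularJets φ k) :
    ContDiffAt ℝ ∞ (sDeriv φ (k + 1)) q := by
  have key : ∀ {k : ℕ} {q : Jet (k + 1)}, q ∈ regularJets φ k →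
      ContDiffAt ℝ ∞ (sDeriv φ k) (q.restrict (Nat.le_succ _)) →
      ContDiffAt ℝ ∞ (sDeriv φ (k + 1)) q := by
    intro k q hq h
    refine ((contDiffAt_totalDeriv h).div (contDiffAt_slope (contDiffAt_chart hφ hq.1))
      hq.2).congr_of_eventuallyEq ?_
    filter_upwards [(isOpen_regularJets hφ k).mem_nhds hq] with p hp
    simp only [sDeriv]
    rw [totalDeriv_fst_comp_base (differentiableAt_chart hφ hp.1), Pi.div_apply]
  induction k with
  | zero => exact key hq (contDiffAt_sDeriv_zero hφ hq.1)
  -- `slope` involves only the base point and `y₁`, so `hq` serves unchanged for the restricted jet.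
  | succ k ih => exact key hq (ih hq)

theorem contDiffAt_prolong {φ : OpenPartialHomeomorph (ℝ × ℝ) (ℝ × ℝ)}
    (hφ : ContDiffOn ℝ ∞ φ φ.source) {k : ℕ} {q : Jet (k + 1)} (hq : q ∈ regularJets φ k) :
    ContDiffAt ℝ ∞ (prolong φ : Jet (k + 1) → Jet (k + 1)) q := by
  refine ContDiffAt.prodMk
    (ContDiffAt.comp q (contDiffAt_chart hφ hq.1) contDiff_base.contDiffAt).fst
    (contDiffAt_pi.2 fun i => ?_)
  obtain ⟨i, hi⟩ := i
  cases i with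
  | zero =>
    exact ContDiffAt.comp (g := sDeriv φ 0) q (contDiffAt_sDeriv_zero hφ hq.1)
      (contDiff_restrict (Nat.succ_le_of_lt hi)).contDiffAt
  | succ i =>
    exact ContDiffAt.comp (g := sDeriv φ (i + 1)) q
      (contDiffAt_sDeriv_succ hφ (q := q.restrict (Nat.succ_le_of_lt hi)) hq)
      (contDiff_restrict (Nat.succ_le_of_lt hi)).contDiffAt

theorem hasDerivAt_chart_graph {φ : OpenPartialHomeomorph (ℝ × ℝ) (ℝ × ℝ)}
    (hφ : ContDiffOn ℝ ∞ φ φ.source) {f : ℝ → ℝ} {x : ℝ} (hf : DifferentiableAt ℝ f x)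
    (hx : (x, f x) ∈ φ.source) :
    HasDerivAt (fun t => φ (t, f t)) (fderiv ℝ φ (x, f x) (1, deriv f x)) x :=
  (differentiableAt_chart hφ hx).hasFDerivAt.comp_hasDerivAt x
    ((hasDerivAt_id x).prodMk hf.hasDerivAt)

theorem hasDerivAt_fst_chart_graph {φ : OpenPartialHomeomorph (ℝ × ℝ) (ℝ × ℝ)}
    (hφ : ContDiffOn ℝ ∞ φ φ.source) {f : ℝ → ℝ} {x : ℝ} (hf : DifferentiableAt ℝ f x)
    (hx : (x, f x) ∈ φ.source) :
    HasDerivAt (fun t => (φ (t, f t)).1) (fderiv ℝ φ (x, f x) (1, deriv f x)).1 x :=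
  (ContinuousLinearMap.fst ℝ ℝ ℝ).hasFDerivAt.comp_hasDerivAt x (hasDerivAt_chart_graph hφ hf hx)

theorem hasDerivAt_snd_chart_graph {φ : OpenPartialHomeomorph (ℝ × ℝ) (ℝ × ℝ)}
    (hφ : ContDiffOn ℝ ∞ φ φ.source) {f : ℝ → ℝ} {x : ℝ} (hf : DifferentiableAt ℝ f x)
    (hx : (x, f x) ∈ φ.source) :
    HasDerivAt (fun t => (φ (t, f t)).2) (fderiv ℝ φ (x, f x) (1, deriv f x)).2 x :=
  (ContinuousLinearMap.snd ℝ ℝ ℝ).hasFDerivAt.comp_hasDerivAt x (hasDerivAt_chart_graph hφ hf hx)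

theorem slope_jet (φ : ℝ × ℝ → ℝ × ℝ) (k : ℕ) (f : ℝ → ℝ) (x : ℝ) :
    slope φ (jet (k + 1) f x) = (fderiv ℝ φ (x, f x) (1, deriv f x)).1 := by
  simp [slope, jet, Jet.base]

theorem base_jet (k : ℕ) (f : ℝ → ℝ) (x : ℝ) : (jet k f x).base = (x, f x) := by
  simp [jet, Jet.base]

/-- Differentiating `d^k s/dr^k = g^{(k)}(r)` along the graph of `f` gives `D_x (d^k s/dr^k) =
g^{(k+1)}(r) · D_x r`, which is the recursion defining `sDeriv`. Regularity of the jets comes for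
free: a curve that is a graph over `r` cannot have `D_x r = 0`. -/
theorem prolong_jet_eq {φ : OpenPartialHomeomorph (ℝ × ℝ) (ℝ × ℝ)}
    (hφ : ContDiffOn ℝ ∞ φ φ.source) (hφ' : ContDiffOn ℝ ∞ φ.symm φ.target)
    {n : ℕ} {f g : ℝ → ℝ} {I K : Set ℝ} (hI : IsOpen I) (hK : IsOpen K)
    (hf : ContDiffOn ℝ (n + 1 : ℕ) f I) (hg : ContDiffOn ℝ (n + 1 : ℕ) g K)
    (h : ∀ x ∈ I, (x, f x) ∈ φ.source ∧ (φ (x, f x)).1 ∈ K ∧ (φ (x, f x)).2 = g (φ (x, f x)).1)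
    {x : ℝ} (hx : x ∈ I) :
    jet (n + 1) f x ∈ regularJets φ n ∧
      prolong φ (jet (n + 1) f x) = jet (n + 1) g (φ (x, f x)).1 := by
  have hfAt : ∀ y ∈ I, ContDiffAt ℝ (n + 1 : ℕ) f y := fun y hy => hf.contDiffAt (hI.mem_nhds hy)
  have hgAt : ∀ y ∈ K, ContDiffAt ℝ (n + 1 : ℕ) g y := fun y hy => hg.contDiffAt (hK.mem_nhds hy)
  have hfd : ∀ y ∈ I, DifferentiableAt ℝ f y := fun y hy => (hfAt y hy).differentiableAt (by simp)
  have hreg : ∀ y ∈ I, jet (n + 1) f y ∈ regularJets φ n := by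
    intro y hy
    refine ⟨by rw [base_jet]; exact (h y hy).1, fun h0 => ?_⟩
    rw [slope_jet] at h0
    have h1 := hasDerivAt_fst_chart_graph hφ (hfd y hy) (h y hy).1
    have h2 := hasDerivAt_snd_chart_graph hφ (hfd y hy) (h y hy).1
    have h3 := ((hgAt _ (h y hy).2.1).differentiableAt (by simp)).hasDerivAt.comp y h1
    have h4 := h3.congr_of_eventuallyEq
      (Filter.eventually_of_mem (hI.mem_nhds hy) fun t ht => (h t ht).2.2)
    have h5 := h2.unique h4
    rw [h0, mul_zero] at h5
    -- If `D_x r = 0`, then `D_x s = g' · D_x r = 0` too, so the invertible `dφ` would kill the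
    -- vector `(1, f')`.
    have h6 := fderiv_symm_fderiv hφ hφ' (h y hy).1 (1, deriv f y)
    rw [Prod.ext h0 h5 (y := (0 : ℝ × ℝ)), map_zero] at h6
    exact zero_ne_one (congrArg Prod.fst h6)
  refine ⟨hreg x hx, Prod.ext (by simp only [prolong, base_jet]; rfl) (funext fun i => ?_)⟩
  have key : ∀ k ≤ n + 1, ∀ y ∈ I, sDeriv φ k (jet k f y) = iteratedDeriv k g (φ (y, f y)).1 := by
    intro k
    induction k with
    | zero =>
      intro _ y hy
      simp only [sDeriv, base_jet, iteratedDeriv_zero]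
      exact (h y hy).2.2
    | succ k ih =>
      intro hk y hy
      have hd : DifferentiableAt ℝ (sDeriv φ k) (jet k f y) := by
        cases k with
        | zero =>
          exact (contDiffAt_sDeriv_zero hφ (by rw [base_jet]; exact (h y hy).1)).differentiableAt
            (by simp)
        | succ k =>
          exact (contDiffAt_sDeriv_succ hφ (q := jet (k + 1) f y) (hreg y hy)).differentiableAt
            (by simp)
      have h1 := hasDerivAt_comp_jet ((hfAt y hy).of_le (by exact_mod_cast hk)) hd
      have h2 := (differentiableAt_iteratedDeriv (k := n) (i := k) (hgAt _ (h y hy).2.1)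
        (by omega)).hasDerivAt.comp y
        (hasDerivAt_fst_chart_graph hφ (hfd y hy) (h y hy).1)
      have h3 := h2.congr_of_eventuallyEq (Filter.eventually_of_mem (hI.mem_nhds hy)
        fun t ht => ih (by omega) t ht)
      have h4 := h1.unique h3
      have h5 : slope φ (jet (k + 1) f y) ≠ 0 := (hreg y hy).2
      simp only [sDeriv]
      rw [totalDeriv_fst_comp_base (by rw [base_jet]; exact differentiableAt_chart hφ (h y hy).1),
        div_eq_iff h5, h4, slope_jet, iteratedDeriv_succ]
  exact key i (Nat.le_of_lt_succ i.2) x hx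

/-! ### Inverse functions on intervals -/

/-- Rolle's theorem. -/
theorem injOn_of_hasDerivAt_ne_zero {ρ ρ' : ℝ → ℝ} {I : Set ℝ} (hI : I.OrdConnected)
    (hρ : ∀ x ∈ I, HasDerivAt ρ (ρ' x) x) (h0 : ∀ x ∈ I, ρ' x ≠ 0) : InjOn ρ I := by
  have key : ∀ a ∈ I, ∀ b ∈ I, a < b → ρ a ≠ ρ b := by
    intro a ha b hb hab he
    have hsub := hI.out ha hb
    obtain ⟨c, hc, hc0⟩ := exists_hasDerivAt_eq_zero hab
      (fun x hx => (hρ x (hsub hx)).continuousAt.continuousWithinAt) he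
      (fun x hx => hρ x (hsub (Ioo_subset_Icc_self hx)))
    exact h0 c (hsub (Ioo_subset_Icc_self hc)) hc0
  intro a ha b hb he
  by_contra hne
  rcases lt_or_gt_of_ne hne with hlt | hlt
  · exact key a ha b hb hlt he
  · exact key b hb a ha hlt he.symm

/-- The inverse function theorem gives a smooth local inverse; global injectivity forces
`Function.invFunOn` to agree with it near `ρ x`. -/
theorem contDiffAt_invFunOn {ρ ρ' : ℝ → ℝ} {I : Set ℝ} (hI : IsOpen I) (hinj : InjOn ρ I)
    {m : ℕ} (hm : m ≠ 0) (hc : ContDiffOn ℝ m ρ I) (hρ : ∀ x ∈ I, HasDerivAt ρ (ρ' x) x)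
    (h0 : ∀ x ∈ I, ρ' x ≠ 0) {x : ℝ} (hx : x ∈ I) :
    ρ '' I ∈ 𝓝 (ρ x) ∧ ContDiffAt ℝ m (Function.invFunOn ρ I) (ρ x) := by
  have hm' : (m : WithTop ℕ∞) ≠ 0 := by exact_mod_cast hm
  have hcx := hc.contDiffAt (hI.mem_nhds hx)
  let e : ℝ ≃L[ℝ] ℝ := ContinuousLinearEquiv.unitsEquivAut ℝ (Units.mk0 (ρ' x) (h0 x hx))
  have he : HasFDerivAt ρ (e : ℝ →L[ℝ] ℝ) x := by
    have : (e : ℝ →L[ℝ] ℝ) = ContinuousLinearMap.toSpanSingleton ℝ (ρ' x) := by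
      ext; simp [e]
    rw [this]
    exact hρ x hx
  have hs := hcx.hasStrictFDerivAt' he hm'
  have hmem : ρ '' I ∈ 𝓝 (ρ x) := by
    rw [← hs.map_nhds_eq_of_equiv]
    exact image_mem_map (hI.mem_nhds hx)
  refine ⟨hmem, (hcx.to_localInverse he hm').congr_of_eventuallyEq ?_⟩
  have hcont := (hcx.to_localInverse he hm').continuousAt
  have hval : hcx.localInverse he hm' (ρ x) = x := hcx.localInverse_apply_image he hm'
  rw [ContinuousAt, hval] at hcont
  filter_upwards [hcont (hI.mem_nhds hx), hs.eventually_right_inverse, hmem] with y h1 h2 h3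
  refine hinj (Function.invFunOn_mem h3) h1 ?_
  rw [Function.invFunOn_eq h3]
  exact h2.symm

/-! ### Graphs in new coordinates -/

/-- Since `D_x r ≠ 0` along the graph, `r` is a valid parameter on all of `I`, and `g` is `s`
composed with the inverse of `ρ`. -/
theorem exists_graph_chart {φ : OpenPartialHomeomorph (ℝ × ℝ) (ℝ × ℝ)}
    (hφ : ContDiffOn ℝ ∞ φ φ.source) {n : ℕ} {f : ℝ → ℝ} {I : Set ℝ} (hI : IsOpen I)
    (hI' : IsConnected I) (hf : ContDiffOn ℝ (n + 1 : ℕ) f I)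
    (h : ∀ x ∈ I, jet (n + 1) f x ∈ regularJets φ n) :
    InjOn (fun x => (φ (x, f x)).1) I ∧ IsOpen ((fun x => (φ (x, f x)).1) '' I) ∧
      IsConnected ((fun x => (φ (x, f x)).1) '' I) ∧
      ∃ g : ℝ → ℝ, ContDiffOn ℝ (n + 1 : ℕ) g ((fun x => (φ (x, f x)).1) '' I) ∧
        ∀ x ∈ I, g (φ (x, f x)).1 = (φ (x, f x)).2 := by
  set ρ : ℝ → ℝ := fun x => (φ (x, f x)).1
  have hsrc : ∀ x ∈ I, (x, f x) ∈ φ.source := fun x hx => by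
    have := (h x hx).1
    rwa [base_jet] at this
  have hfAt : ∀ y ∈ I, ContDiffAt ℝ (n + 1 : ℕ) f y := fun y hy => hf.contDiffAt (hI.mem_nhds hy)
  have hρ : ∀ x ∈ I, HasDerivAt ρ (fderiv ℝ φ (x, f x) (1, deriv f x)).1 x := fun x hx =>
    hasDerivAt_fst_chart_graph hφ ((hfAt x hx).differentiableAt (by simp)) (hsrc x hx)
  have h0 : ∀ x ∈ I, (fderiv ℝ φ (x, f x) (1, deriv f x)).1 ≠ 0 := fun x hx => by
    rw [← slope_jet φ n]
    exact (h x hx).2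
  have hc : ∀ x ∈ I, ContDiffAt ℝ (n + 1 : ℕ) (fun t => φ (t, f t)) x := fun x hx =>
    ContDiffAt.comp (g := φ) x
      ((contDiffAt_chart hφ (hsrc x hx)).of_le (by exact_mod_cast le_top))
      (contDiffAt_id.prodMk (hfAt x hx))
  have hρc : ContDiffOn ℝ (n + 1 : ℕ) ρ I := fun x hx => (hc x hx).fst.contDiffWithinAt
  have hinj : InjOn ρ I := injOn_of_hasDerivAt_ne_zero hI'.isPreconnected.ordConnected hρ h0
  have hinv := fun x (hx : x ∈ I) =>
    contDiffAt_invFunOn hI hinj (m := n + 1) (by simp) hρc hρ h0 hx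
  refine ⟨hinj, ?_, hI'.image ρ hρc.continuousOn,
    fun r => (φ (Function.invFunOn ρ I r, f (Function.invFunOn ρ I r))).2, ?_, ?_⟩
  · rw [isOpen_iff_mem_nhds]
    rintro _ ⟨x, hx, rfl⟩
    exact (hinv x hx).1
  · rintro _ ⟨x, hx, rfl⟩
    refine ContDiffAt.contDiffWithinAt ?_
    refine ContDiffAt.comp (g := fun t => (φ (t, f t)).2) (ρ x) ?_ (hinv x hx).2
    rw [hinj.leftInvOn_invFunOn hx]
    exact (hc x hx).snd
  · intro x hx
    have hx' : Function.invFunOn ρ I (φ (x, f x)).1 = x := hinj.leftInvOn_invFunOn hx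
    simp only [hx']

/-- Realize `q` by a function `f` and let `g` describe the same curve in the new coordinates.
Applying `prolong_jet_eq` from `f` to `g` and back from `g` to `f` returns the jet of `f`, with no
computation of iterated total derivatives. -/
theorem prolong_symm_prolong {φ : OpenPartialHomeomorph (ℝ × ℝ) (ℝ × ℝ)}
    (hφ : ContDiffOn ℝ ∞ φ φ.source) (hφ' : ContDiffOn ℝ ∞ φ.symm φ.target) {n : ℕ}
    {q : Jet (n + 1)} (hq : q ∈ regularJets φ n) :
    prolong φ q ∈ regularJets φ.symm n ∧ prolong φ.symm (prolong φ q) = q := by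
  obtain ⟨f, hf, hfq⟩ := exists_contDiff_jet_eq q
  have hf' : ContDiff ℝ (n + 1 : ℕ) f := hf.of_le (by exact_mod_cast le_top)
  have hmem : ∀ᶠ x in 𝓝 q.1, jet (n + 1) f x ∈ regularJets φ n :=
    (continuousAt_jet isOpen_univ hf'.contDiffOn (mem_univ q.1)).eventually
      ((isOpen_regularJets hφ n).mem_nhds (by rwa [hfq]))
  obtain ⟨δ, hδ, hball⟩ := Metric.eventually_nhds_iff_ball.1 hmem
  set I := Metric.ball q.1 δ
  have hI : IsOpen I := Metric.isOpen_ball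
  have hqI : q.1 ∈ I := Metric.mem_ball_self hδ
  have hfI : ContDiffOn ℝ (n + 1 : ℕ) f I := hf'.contDiffOn
  have hsrc : ∀ x ∈ I, (x, f x) ∈ φ.source := fun x hx => by
    have := (hball x hx).1
    rwa [base_jet] at this
  obtain ⟨-, hK, -, g, hg, hgφ⟩ := exists_graph_chart hφ hI
    ((convex_ball q.1 δ).isConnected ⟨q.1, hqI⟩) hfI hball
  have h1 := prolong_jet_eq hφ hφ' hI hK hfI hg
    (fun x hx => ⟨hsrc x hx, mem_image_of_mem _ hx, (hgφ x hx).symm⟩) hqI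
  have hpt : ∀ x ∈ I, ((φ (x, f x)).1, g (φ (x, f x)).1) = φ (x, f x) := fun x hx =>
    Prod.ext rfl (hgφ x hx)
  have h2 := prolong_jet_eq (φ := φ.symm) hφ' (by simpa using hφ) hK hI hg hfI (by
    rintro _ ⟨x, hx, rfl⟩
    simp only [hpt x hx, φ.left_inv (hsrc x hx), OpenPartialHomeomorph.symm_source]
    exact ⟨φ.map_source (hsrc x hx), hx, trivial⟩) (mem_image_of_mem _ hqI)
  rw [← h1.2, hfq] at h2
  refine ⟨h2.1, h2.2.trans ?_⟩
  simp only [hpt _ hqI, φ.left_inv (hsrc _ hqI), hfq]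

/-! ### Flows and rectifying coordinates -/

theorem eqOn_of_hasDerivAt_eq {G : Type*} [NormedAddCommGroup G] [NormedSpace ℝ G] {I : Set ℝ}
    (hI : IsOpen I) (hI' : IsPreconnected I) {f g d : ℝ → G}
    (hf : ∀ t ∈ I, HasDerivAt f (d t) t) (hg : ∀ t ∈ I, HasDerivAt g (d t) t) {x : ℝ}
    (hx : x ∈ I) (h : f x = g x) : EqOn f g I :=
  hI.eqOn_of_deriv_eq hI' (fun t ht => (hf t ht).differentiableAt.differentiableWithinAt)
    (fun t ht => (hg t ht).differentiableAt.differentiableWithinAt)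
    (fun t ht => (hf t ht).deriv.trans (hg t ht).deriv.symm) hx h

/-- The group law moves the derivative at time `ε` to the derivative at time `0` at the point `Φ ε
p`. -/
theorem IsLocalOneParameterGroup.hasDerivAt {M : Set (ℝ × ℝ)} {dom : Set (ℝ × (ℝ × ℝ))}
    {Φ : ℝ → ℝ × ℝ → ℝ × ℝ} (hΦ : IsLocalOneParameterGroup M dom Φ)
    {v : ℝ × ℝ → ℝ × ℝ} (hv : IsGenerator M Φ v) {ε : ℝ} {p : ℝ × ℝ} (h : (ε, p) ∈ dom) :
    HasDerivAt (fun t => Φ t p) (v (Φ ε p)) ε := by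
  have hM := hΦ.mapsTo ε p h
  have h1 : HasDerivAt (fun δ => Φ (δ + ε) p) (v (Φ ε p)) 0 := by
    refine (hv _ hM).congr_of_eventuallyEq ?_
    have c1 : ∀ᶠ δ in 𝓝 (0 : ℝ), (δ, Φ ε p) ∈ dom :=
      (Continuous.continuousAt (by fun_prop : Continuous fun δ : ℝ => (δ, Φ ε p))).eventually
        (hΦ.isOpen_dom.mem_nhds (hΦ.zero_mem _ hM))
    have c2 : ∀ᶠ δ in 𝓝 (0 : ℝ), (δ + ε, p) ∈ dom :=
      (Continuous.continuousAt (by fun_prop : Continuous fun δ : ℝ => (δ + ε, p))).eventually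
        (hΦ.isOpen_dom.mem_nhds (by simpa using h))
    filter_upwards [c1, c2] with δ h1 h2
    exact (hΦ.map_add δ ε p h h1 h2).symm
  have h2 := HasDerivAt.comp_sub_const (f := fun δ => Φ (δ + ε) p) ε ε (by simpa using h1)
  simpa using h2

theorem exists_continuousLinearEquiv_of_injective {F : Type*} [NormedAddCommGroup F]
    [NormedSpace ℝ F] [FiniteDimensional ℝ F] (L : F →L[ℝ] F) (hL : Function.Injective L) :
    ∃ e : F ≃L[ℝ] F, (e : F →L[ℝ] F) = L :=
  ⟨(LinearEquiv.ofInjectiveEndo L.toLinearMap hL).toContinuousLinearEquiv, by ext; rfl⟩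

theorem exists_linearIndependent_direction {w : ℝ × ℝ} (hw : w ≠ 0) :
    ∃ u : ℝ × ℝ, ∀ a b : ℝ, a • u + b • w = 0 → a = 0 ∧ b = 0 := by
  by_cases h1 : w.1 = 0
  · have h2 : w.2 ≠ 0 := fun h2 => hw (Prod.ext h1 h2)
    refine ⟨(1, 0), fun a b h => ?_⟩
    have e1 := congrArg Prod.fst h
    have e2 := congrArg Prod.snd h
    simp [h1, h2] at e1 e2
    exact ⟨e1, e2⟩
  · refine ⟨(0, 1), fun a b h => ?_⟩
    have e1 := congrArg Prod.fst h
    have e2 := congrArg Prod.snd h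
    simp [h1] at e1 e2
    subst e1
    simpa using e2

/-- Flow box: follow the flow for time `s` from the points `p₀ + r • u` of a line transverse to `v
p₀`. The differential of this map at the origin sends the basis to `u` and `v p₀`, so it is
invertible there. -/
theorem exists_rectifyingChart {M : Set (ℝ × ℝ)} {dom : Set (ℝ × (ℝ × ℝ))}
    {Φ : ℝ → ℝ × ℝ → ℝ × ℝ} (hΦ : IsLocalOneParameterGroup M dom Φ)
    {v : ℝ × ℝ → ℝ × ℝ} (hv : IsGenerator M Φ v) {p₀ : ℝ × ℝ} (hp₀ : p₀ ∈ M) (hv0 : v p₀ ≠ 0) :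
    ∃ φ : OpenPartialHomeomorph (ℝ × ℝ) (ℝ × ℝ), IsRectifyingChart M v φ ∧ p₀ ∈ φ.source := by
  obtain ⟨u, hu⟩ := exists_linearIndependent_direction hv0
  let γ : ℝ × ℝ → ℝ × (ℝ × ℝ) := fun z => (z.2, p₀ + z.1 • u)
  have hγ : ContDiff ℝ ∞ γ := by fun_prop
  let ψ : ℝ × ℝ → ℝ × ℝ := fun z => Φ z.2 (p₀ + z.1 • u)
  set S : Set (ℝ × ℝ) := γ ⁻¹' dom with hS
  have hSo : IsOpen S := hΦ.isOpen_dom.preimage hγ.continuous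
  have hψ : ContDiffOn ℝ ∞ ψ S :=
    ContDiffOn.comp (g := fun z : ℝ × (ℝ × ℝ) => Φ z.1 z.2) hΦ.smooth hγ.contDiffOn
      (fun _ hz => hz)
  have hψAt : ∀ z ∈ S, ContDiffAt ℝ ∞ ψ z := fun z hz => hψ.contDiffAt (hSo.mem_nhds hz)
  have hψd : ∀ z ∈ S, HasFDerivAt ψ (fderiv ℝ ψ z) z := fun z hz =>
    ((hψAt z hz).differentiableAt (by simp)).hasFDerivAt
  have h0S : (0 : ℝ × ℝ) ∈ S := by simpa [hS, γ] using hΦ.zero_mem p₀ hp₀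
  have hψ0 : ψ 0 = p₀ := by simpa [ψ] using hΦ.map_zero p₀ hp₀
  have hflow : ∀ z ∈ S, fderiv ℝ ψ z (0, 1) = v (ψ z) := by
    intro z hz
    have h1 : HasDerivAt (fun t : ℝ => ψ (z.1, t)) (fderiv ℝ ψ z (0, 1)) z.2 :=
      HasFDerivAt.comp_hasDerivAt (l := ψ) (f := fun t : ℝ => ((z.1, t) : ℝ × ℝ)) z.2 (hψd z hz)
        ((hasDerivAt_const z.2 z.1).prodMk (hasDerivAt_id' z.2))
    exact h1.unique (hΦ.hasDerivAt hv hz)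
  have hdir : fderiv ℝ ψ 0 (1, 0) = u := by
    have h1 : HasDerivAt (fun t : ℝ => ψ (t, 0)) (fderiv ℝ ψ 0 (1, 0)) 0 :=
      HasFDerivAt.comp_hasDerivAt (l := ψ) (f := fun t : ℝ => ((t, 0) : ℝ × ℝ)) (0 : ℝ) (hψd 0 h0S)
        ((hasDerivAt_id' (0 : ℝ)).prodMk (hasDerivAt_const _ _))
    have h2 : HasDerivAt (fun t : ℝ => p₀ + t • u) u 0 := by
      simpa using ((hasDerivAt_id (0 : ℝ)).smul_const u).const_add p₀
    refine h1.unique (h2.congr_of_eventuallyEq ?_)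
    have : ∀ᶠ t in 𝓝 (0 : ℝ), p₀ + t • u ∈ M :=
      (Continuous.continuousAt (by fun_prop : Continuous fun t : ℝ => p₀ + t • u)).eventually
        (hΦ.isOpen_space.mem_nhds (by simpa using hp₀))
    filter_upwards [this] with t ht
    exact hΦ.map_zero _ ht
  have hinj : Function.Injective (fderiv ℝ ψ 0) := by
    rw [injective_iff_map_eq_zero]
    rintro ⟨a, b⟩ hab
    have hsplit : ((a, b) : ℝ × ℝ) = a • (1, 0) + b • (0, 1) := by simp
    rw [hsplit, map_add, map_smul, map_smul, hdir, hflow 0 h0S, hψ0] at hab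
    obtain ⟨rfl, rfl⟩ := hu a b hab
    rfl
  obtain ⟨e₀, he₀⟩ := exists_continuousLinearEquiv_of_injective _ hinj
  have hd0 : HasFDerivAt ψ (e₀ : ℝ × ℝ →L[ℝ] ℝ × ℝ) 0 := he₀ ▸ hψd 0 h0S
  let h := (hψAt 0 h0S).toOpenPartialHomeomorph ψ hd0 (by simp)
  -- Restricting to the open set where the differential is invertible makes the inverse smooth on
  -- the whole target, not only at `p₀`.
  set W : Set (ℝ × ℝ) := S ∩ fderiv ℝ ψ ⁻¹'
    range ((↑) : ((ℝ × ℝ) ≃L[ℝ] (ℝ × ℝ)) → (ℝ × ℝ →L[ℝ] ℝ × ℝ))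
  have hWo : IsOpen W := (hψ.continuousOn_fderiv_of_isOpen hSo (by simp)).isOpen_inter_preimage
    hSo ContinuousLinearEquiv.isOpen
  let h' := h.restrOpen W hWo
  have hsrc : ∀ z ∈ h'.source, z ∈ W := fun z hz => by
    rw [OpenPartialHomeomorph.restrOpen_source] at hz
    exact hz.2
  have hsm : ContDiffOn ℝ ∞ h' h'.source := fun z hz =>
    (hψAt z (hsrc z hz).1).contDiffWithinAt
  have hsm' : ContDiffOn ℝ ∞ h'.symm h'.target := by
    intro p hp
    obtain ⟨hzS, e, he⟩ := hsrc _ (h'.map_target hp)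
    exact (h'.contDiffAt_symm hp (he ▸ hψd _ hzS) (hψAt _ hzS)).contDiffWithinAt
  refine ⟨h'.symm, ⟨?_, hsm', hsm, ?_⟩, ?_⟩
  · intro p hp
    have hz := (hsrc _ (h'.map_target hp)).1
    have := hΦ.mapsTo _ _ hz
    rwa [show Φ (h'.symm p).2 (p₀ + (h'.symm p).1 • u) = p from h'.right_inv hp] at this
  · intro p hp
    have hz := h'.map_target hp
    have h1 := fderiv_symm_fderiv hsm hsm' hz (0, 1)
    have h2 : fderiv ℝ h' (h'.symm p) (0, 1) = v (h' (h'.symm p)) := hflow _ (hsrc _ hz).1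
    rwa [h2, h'.right_inv hp] at h1
  · have h0 : (0 : ℝ × ℝ) ∈ h'.source := by
      rw [OpenPartialHomeomorph.restrOpen_source]
      exact ⟨(hψAt 0 h0S).mem_toOpenPartialHomeomorph_source hd0 (by simp), h0S, e₀, he₀⟩
    have := h'.map_source h0
    rwa [show h' 0 = p₀ from hψ0] at this

/-- Along an orbit, `φ (Φ t p)` has constant derivative `dφ(v) = (0, 1)`. The neighbourhood `N` is
chosen before `ε`, which gives uniformity in `p`. -/
theorem IsRectifyingChart.eventually_flow {M : Set (ℝ × ℝ)} {dom : Set (ℝ × (ℝ × ℝ))}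
    {Φ : ℝ → ℝ × ℝ → ℝ × ℝ} (hΦ : IsLocalOneParameterGroup M dom Φ)
    {v : ℝ × ℝ → ℝ × ℝ} (hv : IsGenerator M Φ v) {φ : OpenPartialHomeomorph (ℝ × ℝ) (ℝ × ℝ)}
    (hφ : IsRectifyingChart M v φ) {p₀ : ℝ × ℝ} (hp₀ : p₀ ∈ φ.source) :
    ∃ N ∈ 𝓝 p₀, ∀ᶠ ε in 𝓝 (0 : ℝ), ∀ p ∈ N,
      (ε, p) ∈ dom ∧ Φ ε p ∈ φ.source ∧ φ (Φ ε p) = φ p + (0, ε) := by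
  have hM := hφ.source_subset hp₀
  have h0 := hΦ.zero_mem p₀ hM
  have hS : dom ∩ (fun z : ℝ × (ℝ × ℝ) => Φ z.1 z.2) ⁻¹' φ.source ∈ 𝓝 ((0 : ℝ), p₀) :=
    (hΦ.smooth.continuousOn.isOpen_inter_preimage hΦ.isOpen_dom φ.open_source).mem_nhds
      ⟨h0, by simpa [hΦ.map_zero p₀ hM] using hp₀⟩
  obtain ⟨A, hA, N, hN, hAN⟩ := mem_nhds_prod_iff.1 hS
  obtain ⟨δ, hδ, hball⟩ := Metric.mem_nhds_iff.1 hA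
  refine ⟨N, hN, ?_⟩
  filter_upwards [Metric.ball_mem_nhds (0 : ℝ) hδ] with ε hε p hp
  have hmem : ∀ t ∈ Metric.ball (0 : ℝ) δ, (t, p) ∈ dom ∧ Φ t p ∈ φ.source :=
    fun t ht => hAN ⟨hball ht, hp⟩
  refine ⟨(hmem ε hε).1, (hmem ε hε).2, ?_⟩
  refine eqOn_of_hasDerivAt_eq (f := fun t => φ (Φ t p)) (g := fun t => φ p + (0, t))
    (d := fun _ => (0, 1)) Metric.isOpen_ball (convex_ball (0 : ℝ) δ).isPreconnected
    (fun t ht => ?_) (fun t _ => ?_) (Metric.mem_ball_self hδ) ?_ hε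
  · have h1 := (differentiableAt_chart hφ.smooth (hmem t ht).2).hasFDerivAt.comp_hasDerivAt t
      (hΦ.hasDerivAt hv (hmem t ht).1)
    rwa [hφ.rectifies _ (hmem t ht).2] at h1
  · exact ((hasDerivAt_const t (0 : ℝ)).prodMk (hasDerivAt_id t)).const_add _
  · have := hΦ.map_zero p (hΦ.mem_space 0 p (hmem 0 (Metric.mem_ball_self hδ)).1)
    simp [this]

/-! ### Local solutions of an equation -/

theorem contDiffOn_of_hasDerivAt_chain {I : Set ℝ} (hI : IsOpen I) {m : ℕ} {y : ℕ → ℝ → ℝ}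
    (hy : ∀ i < m, ∀ t ∈ I, HasDerivAt (y i) (y (i + 1) t) t) (hc : ContinuousOn (y m) I) :
    ContDiffOn ℝ m (y 0) I := by
  induction m generalizing y with
  | zero => simpa using hc
  | succ m ih =>
    have h1 := ih (y := fun i => y (i + 1)) (fun i hi => hy (i + 1) (by omega)) hc
    rw [Nat.cast_succ, contDiffOn_succ_iff_deriv_of_isOpen hI]
    exact ⟨fun t ht => (hy 0 (by omega) t ht).differentiableAt.differentiableWithinAt, by simp,
      h1.congr fun t ht => (hy 0 (by omega) t ht).deriv⟩

theorem iteratedDeriv_of_hasDerivAt_chain {I : Set ℝ} (hI : IsOpen I) {m : ℕ} {y : ℕ → ℝ → ℝ}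
    (hy : ∀ i < m, ∀ t ∈ I, HasDerivAt (y i) (y (i + 1) t) t) {i : ℕ} (hi : i ≤ m) :
    ∀ t ∈ I, iteratedDeriv i (y 0) t = y i t := by
  induction i with
  | zero => simp
  | succ i ih =>
    intro t ht
    rw [iteratedDeriv_succ, Filter.EventuallyEq.deriv_eq
      (Filter.eventually_of_mem (hI.mem_nhds ht) (ih (by omega)))]
    exact (hy i (by omega) t ht).deriv

/-- The part of the total derivative on `J^{k+1}` that does not involve `y_{k+2}`. -/
def truncatedField {k : ℕ} (q : Jet (k + 1)) : Jet (k + 1) :=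
  (1, Fin.snoc (fun i : Fin (k + 1) => q.2 i.succ) 0)

/-- Instead of solving `E = 0` for the top derivative, integrate a vector field on the jet space.
Its lower components are those of the total derivative, so integral curves are jets of functions;
its top component is chosen so that `E` is constant along them. -/
theorem exists_isSolution {n : ℕ} {Ω : Set (Jet (n + 1))} {E : Jet (n + 1) → ℝ}
    (hE : IsODE (n + 1) Ω E) {q : Jet (n + 1)} (hq : q ∈ Ω) (h0 : E q = 0) :
    ∃ (I : Set ℝ) (f : ℝ → ℝ), IsSolution (n + 1) Ω E I f ∧ q.1 ∈ I ∧ jet (n + 1) f q.1 = q := by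
  set e : Jet (n + 1) := (0, Pi.single (Fin.last (n + 1)) 1) with he
  have hT : ContDiff ℝ ∞ (truncatedField : Jet (n + 1) → Jet (n + 1)) := by
    refine contDiff_const.prodMk (contDiff_pi.2 fun i => ?_)
    refine Fin.lastCases ?_ (fun j => ?_) i
    · simpa using contDiff_const
    · simp only [Fin.snoc_castSucc]
      fun_prop
  have hEAt : ContDiffAt ℝ ∞ E q := hE.smooth.contDiffAt (hE.isOpen.mem_nhds hq)
  have hdE : ContDiffAt ℝ ∞ (fderiv ℝ E) q := hEAt.fderiv_right (by simp)
  have hreg : fderiv ℝ E q e ≠ 0 := hE.regular q hq h0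
  -- The coefficient of `e` is the one solving `dE(X) = 0`; the division is legitimate near `q` by
  -- regularity.
  let X : Jet (n + 1) → Jet (n + 1) := fun p =>
    truncatedField p - (fderiv ℝ E p (truncatedField p) / fderiv ℝ E p e) • e
  have hX : ContDiffAt ℝ 1 X q := by
    have h1 : ContDiffAt ℝ ∞ X q := hT.contDiffAt.sub
      (((hdE.clm_apply hT.contDiffAt).div (hdE.clm_apply contDiffAt_const) hreg).smul
        contDiffAt_const)
    exact h1.of_le (by exact_mod_cast le_top)
  obtain ⟨α, hα0, ε, hε, hα⟩ :=
    hX.exists_forall_mem_closedBall_exists_eq_forall_mem_Ioo_hasDerivAt₀ q.1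
  have hαc : ContinuousAt α q.1 := (hα q.1 (by constructor <;> linarith)).continuousAt
  have hev : ∀ᶠ t in 𝓝 q.1, (α t ∈ Ω ∧ fderiv ℝ E (α t) e ≠ 0) ∧ t ∈ Ioo (q.1 - ε) (q.1 + ε) := by
    refine (hαc.eventually (p := fun p => p ∈ Ω ∧ fderiv ℝ E p e ≠ 0) ?_).and
      (Ioo_mem_nhds (sub_lt_self _ hε) (lt_add_of_pos_right _ hε))
    rw [hα0]
    exact Filter.Eventually.and (hE.isOpen.mem_nhds hq)
      ((hdE.clm_apply contDiffAt_const).continuousAt.eventually_ne hreg)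
  obtain ⟨δ, hδ, hball⟩ := Metric.eventually_nhds_iff_ball.1 hev
  set I := Metric.ball q.1 δ
  have hI : IsOpen I := Metric.isOpen_ball
  have hqI : q.1 ∈ I := Metric.mem_ball_self hδ
  have hIc : IsConnected I := (convex_ball q.1 δ).isConnected ⟨q.1, hqI⟩
  have hαI : ∀ t ∈ I, HasDerivAt α (X (α t)) t := fun t ht => hα t (hball t ht).2
  have hfst : ∀ t ∈ I, (α t).1 = t := by
    refine eqOn_of_hasDerivAt_eq (f := fun t => (α t).1) (g := id) (d := fun _ => 1) hI
      hIc.isPreconnected (fun t ht => ?_) (fun t _ => hasDerivAt_id t) hqI (by simp [hα0])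
    have h1 := (ContinuousLinearMap.fst ℝ ℝ (Fin (n + 1 + 1) → ℝ)).hasFDerivAt.comp_hasDerivAt t
      (hαI t ht)
    simpa [X, truncatedField, he, Function.comp_def] using h1
  have hzero : ∀ t ∈ I, E (α t) = 0 := by
    refine eqOn_of_hasDerivAt_eq (f := fun t => E (α t)) (g := fun _ => 0) (d := fun _ => 0) hI
      hIc.isPreconnected (fun t ht => ?_) (fun t _ => hasDerivAt_const t _) hqI (by simp [hα0, h0])
    have h1 := ((hE.smooth.contDiffAt (hE.isOpen.mem_nhds (hball t ht).1.1)).differentiableAt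
      (by simp)).hasFDerivAt.comp_hasDerivAt t (hαI t ht)
    have h2 : fderiv ℝ E (α t) (X (α t)) = 0 := by
      simp only [X, map_sub, map_smul, smul_eq_mul]
      rw [div_mul_cancel₀ _ (hball t ht).1.2, sub_self]
    rwa [h2] at h1
  have hcoord : ∀ i : Fin (n + 1), ∀ t ∈ I,
      HasDerivAt (fun t => (α t).2 i.castSucc) ((α t).2 i.succ) t := by
    intro i t ht
    have h1 := ((ContinuousLinearMap.proj i.castSucc).comp
      (ContinuousLinearMap.snd ℝ ℝ (Fin (n + 1 + 1) → ℝ))).hasFDerivAt.comp_hasDerivAt t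
      (hαI t ht)
    simpa [X, truncatedField, he, Function.comp_def, Fin.castSucc_ne_last] using h1
  -- Indices are taken in `ℕ` to suit the chain lemmas; the reduction modulo `n + 2` has no effect
  -- on `i ≤ n + 1`.
  let y : ℕ → ℝ → ℝ := fun i t => (α t).2 (Fin.ofNat (n + 1 + 1) i)
  have hof : ∀ i : Fin (n + 1 + 1), Fin.ofNat (n + 1 + 1) i = i := fun i =>
    Fin.ext (Nat.mod_eq_of_lt i.2)
  have hy : ∀ i < n + 1, ∀ t ∈ I, HasDerivAt (y i) (y (i + 1) t) t := by
    intro i hi t ht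
    have h1 := hcoord ⟨i, hi⟩ t ht
    rw [← hof (Fin.castSucc _), ← hof (Fin.succ _)] at h1
    exact h1
  have hjet : ∀ t ∈ I, jet (n + 1) (y 0) t = α t := fun t ht =>
    Prod.ext (hfst t ht).symm (funext fun i =>
      (iteratedDeriv_of_hasDerivAt_chain hI hy (Nat.le_of_lt_succ i.2) t ht).trans
        (congrArg (α t).2 (hof i)))
  have hcont : ContinuousOn (y (n + 1)) I := fun t ht =>
    ((continuous_apply _).continuousAt.comp (f := fun t => (α t).2)
      (hαI t ht).continuousAt.snd).continuousWithinAt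
  refine ⟨I, y 0, ⟨hI, hIc, contDiffOn_of_hasDerivAt_chain hI hy hcont, fun t ht => ?_,
    fun t ht => ?_⟩, hqI, (hjet _ hqI).trans hα0⟩
  · rw [hjet t ht]
    exact (hball t ht).1.1
  · rw [hjet t ht]
    exact hzero t ht

/-! ### Splitting off the zeroth derivative -/

/-- The jet `(r, (s, z, z₁, …, z_n))` assembled from `s` and `(r, (z, z₁, …, z_n))`. -/
def consJet {n : ℕ} (s : ℝ) (w : Jet n) : Jet (n + 1) := (w.1, Fin.cons s w.2)

theorem consJet_inj {n : ℕ} {s s' : ℝ} {w w' : Jet n} :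
    consJet s w = consJet s' w' ↔ s = s' ∧ w = w' := by
  simp only [consJet, Prod.ext_iff, Fin.cons_inj]
  tauto

theorem contDiff_consJet {n : ℕ} : ContDiff ℝ ∞ (fun z : ℝ × Jet n => consJet z.1 z.2) := by
  refine contDiff_snd.fst.prodMk (contDiff_pi.2 fun i => ?_)
  refine Fin.cases ?_ (fun j => ?_) i
  · simpa using contDiff_fst
  · simp only [Fin.cons_succ]
    fun_prop

theorem prolong_eq_consJet {n : ℕ} (φ : ℝ × ℝ → ℝ × ℝ) (q : Jet (n + 1)) :
    prolong φ q = consJet (φ q.base).2 (reducedJet φ q) := by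
  refine Prod.ext rfl (funext fun i => ?_)
  refine Fin.cases ?_ (fun j => ?_) i
  · rfl
  · rfl

theorem jet_succ_eq_consJet (n : ℕ) (g : ℝ → ℝ) (r : ℝ) :
    jet (n + 1) g r = consJet (g r) (jet n (deriv g) r) := by
  refine Prod.ext rfl (funext fun i => ?_)
  refine Fin.cases ?_ (fun j => ?_) i
  · simp [jet, consJet]
  · simp [jet, consJet, iteratedDeriv_succ']

theorem jet_congr_of_eqOn {f g : ℝ → ℝ} {I : Set ℝ} (hI : IsOpen I) (h : EqOn f g I) (n : ℕ)
    {x : ℝ} (hx : x ∈ I) : jet n f x = jet n g x :=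
  Prod.ext rfl (funext fun i =>
    Filter.EventuallyEq.iteratedDeriv_eq i (Filter.eventually_of_mem (hI.mem_nhds hx) h))

theorem prolong_prolong_symm {φ : OpenPartialHomeomorph (ℝ × ℝ) (ℝ × ℝ)}
    (hφ : ContDiffOn ℝ ∞ φ φ.source) (hφ' : ContDiffOn ℝ ∞ φ.symm φ.target) {n : ℕ}
    {c : Jet (n + 1)} (hc : c ∈ regularJets φ.symm n) :
    prolong φ.symm c ∈ regularJets φ n ∧ prolong φ (prolong φ.symm c) = c := by
  simpa using prolong_symm_prolong (φ := φ.symm) hφ' (by simpa using hφ) hc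

/-- As `dφ` is injective and sends `v` to `∂_s`, the slope vanishes exactly when `(1, y₁)` is a
multiple of `v`, necessarily a nonzero one. -/
theorem IsRectifyingChart.mem_regularJets_iff {M : Set (ℝ × ℝ)} {v : ℝ × ℝ → ℝ × ℝ}
    {φ : OpenPartialHomeomorph (ℝ × ℝ) (ℝ × ℝ)} (hφ : IsRectifyingChart M v φ) {n : ℕ}
    {q : Jet (n + 1)} : q ∈ regularJets φ n ↔ q.base ∈ φ.source ∧ Transverse v q := by
  refine and_congr_right fun hq => ?_
  have hr := hφ.rectifies _ hq
  constructor
  · intro h c hc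
    rw [hc, map_smul] at hr
    have h1 : c * slope φ q = 0 := congrArg Prod.fst hr
    rcases mul_eq_zero.1 h1 with rfl | h1
    · rw [zero_smul] at hr
      exact zero_ne_one (congrArg Prod.snd hr)
    · exact h h1
  · intro h h0
    set b := (fderiv ℝ φ q.base (1, q.2 1)).2 with hb
    have h1 : fderiv ℝ φ q.base (1, q.2 1) = fderiv ℝ φ q.base (b • v q.base) := by
      rw [map_smul, hr]
      exact Prod.ext (by simpa [slope] using h0) (by simp [hb])
    have h2 : ((1, q.2 1) : ℝ × ℝ) = b • v q.base := by
      rw [← fderiv_symm_fderiv hφ.smooth hφ.smooth_symm hq (1, q.2 1), h1,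
        fderiv_symm_fderiv hφ.smooth hφ.smooth_symm hq]
    have hb0 : b ≠ 0 := by
      intro hb0
      rw [hb0, zero_smul] at h2
      exact one_ne_zero (congrArg Prod.fst h2)
    exact h b⁻¹ (by rw [h2, smul_smul, inv_mul_cancel₀ hb0, one_smul])

theorem nowhereTangent_iff (n : ℕ) {v : ℝ × ℝ → ℝ × ℝ} {I : Set ℝ} {f : ℝ → ℝ} :
    NowhereTangent v I f ↔ ∀ x ∈ I, Transverse v (jet (n + 1) f x) := by
  simp [NowhereTangent, Transverse, jet, Jet.base]

/-! ### Reduction domains -/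

/-- The coordinate tuples coming from regular jets in `Ω` contain a neighbourhood of that of `q`,
hence a product box. -/
theorem IsRectifyingChart.exists_isReductionDomain {M : Set (ℝ × ℝ)} {v : ℝ × ℝ → ℝ × ℝ}
    {φ : OpenPartialHomeomorph (ℝ × ℝ) (ℝ × ℝ)} (hφ : IsRectifyingChart M v φ) {n : ℕ}
    {Ω : Set (Jet (n + 1))} (hΩ : IsOpen Ω) {q : Jet (n + 1)} (hq : q ∈ Ω)
    (hqr : q ∈ regularJets φ n) :
    ∃ (D : Set (Jet n)) (J : Set ℝ), IsReductionDomain Ω v φ D J ∧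
      reducedJet φ q ∈ D ∧ (φ q.base).2 ∈ J := by
  obtain ⟨hc, hcq⟩ := prolong_symm_prolong hφ.smooth hφ.smooth_symm hqr
  have hA : ∀ᶠ c in 𝓝 (prolong φ q), c ∈ regularJets φ.symm n ∧ prolong φ.symm c ∈ Ω :=
    Filter.Eventually.and ((isOpen_regularJets (φ := φ.symm) hφ.smooth_symm n).mem_nhds hc)
      ((contDiffAt_prolong (φ := φ.symm) hφ.smooth_symm hc).continuousAt.eventually
        (hΩ.mem_nhds (by rwa [hcq])))
  rw [prolong_eq_consJet] at hA
  obtain ⟨A, hA', B, hB, hAB⟩ := mem_nhds_prod_iff.1 <|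
    (contDiff_consJet.continuous.continuousAt (x := ((φ q.base).2, reducedJet φ q))).eventually hA
  obtain ⟨δ, hδ, hball⟩ := Metric.mem_nhds_iff.1 hA'
  obtain ⟨D, hDB, hD, hqD⟩ := mem_nhds_iff.1 hB
  refine ⟨D, Metric.ball (φ q.base).2 δ, ⟨hD, Metric.isOpen_ball,
    (convex_ball _ δ).isConnected ⟨_, Metric.mem_ball_self hδ⟩, fun w hw s hs => ?_⟩, hqD,
    Metric.mem_ball_self hδ⟩
  obtain ⟨h1, h2⟩ := hAB (mk_mem_prod (hball hs) (hDB hw))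
  obtain ⟨h3, h4⟩ := prolong_prolong_symm hφ.smooth hφ.smooth_symm h1
  rw [prolong_eq_consJet, consJet_inj] at h4
  obtain ⟨h5, h6⟩ := hφ.mem_regularJets_iff.1 h3
  exact ⟨_, h2, h5, h6, h4⟩

/-- The jet promised by `exists_jet` can only be the inverse prolongation, which depends smoothly on
`(s, w)`. -/
theorem IsReductionDomain.mem {M : Set (ℝ × ℝ)} {v : ℝ × ℝ → ℝ × ℝ}
    {φ : OpenPartialHomeomorph (ℝ × ℝ) (ℝ × ℝ)} (hφ : IsRectifyingChart M v φ) {n : ℕ}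
    {Ω : Set (Jet (n + 1))} {D : Set (Jet n)} {J : Set ℝ} (hD : IsReductionDomain Ω v φ D J)
    {w : Jet n} (hw : w ∈ D) {s : ℝ} (hs : s ∈ J) :
    consJet s w ∈ regularJets φ.symm n ∧ prolong φ.symm (consJet s w) ∈ Ω := by
  obtain ⟨q, hq, h1, h2, rfl, rfl⟩ := hD.exists_jet w hw s hs
  obtain ⟨h3, h4⟩ := prolong_symm_prolong hφ.smooth hφ.smooth_symm
    (hφ.mem_regularJets_iff.2 ⟨h1, h2⟩)
  rw [prolong_eq_consJet φ] at h3 h4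
  exact ⟨h3, by rwa [h4]⟩

/-! ### Invariance of the equation under translations of `s` -/

/-- Take a solution through `q`, written `s = g(r)`. Its image under `Φ ε` is again a solution and,
near the image point, is the curve `s = g(r) + ε`; `q'` is the jet of that solution there. -/
theorem IsSymmetryGroup.eventually_translate {M : Set (ℝ × ℝ)} {dom : Set (ℝ × (ℝ × ℝ))}
    {Φ : ℝ → ℝ × ℝ → ℝ × ℝ} (hΦ : IsLocalOneParameterGroup M dom Φ)
    {v : ℝ × ℝ → ℝ × ℝ} (hv : IsGenerator M Φ v) {n : ℕ} {Ω : Set (Jet (n + 1))}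
    {E : Jet (n + 1) → ℝ} (hE : IsODE (n + 1) Ω E) (hsymm : IsSymmetryGroup (n + 1) Ω E dom Φ)
    {φ : OpenPartialHomeomorph (ℝ × ℝ) (ℝ × ℝ)} (hφ : IsRectifyingChart M v φ)
    {q : Jet (n + 1)} (hq : q ∈ Ω) (hqr : q ∈ regularJets φ n) (h0 : E q = 0) :
    ∀ᶠ ε in 𝓝 (0 : ℝ), ∃ q' ∈ Ω, q' ∈ regularJets φ n ∧ E q' = 0 ∧
      prolong φ q' = consJet ((φ q.base).2 + ε) (reducedJet φ q) := by
  obtain ⟨I, f, hf, hxI, hfq⟩ := exists_isSolution hE hq h0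
  set x₀ := q.1
  have hbase : q.base = (x₀, f x₀) := by rw [← hfq, base_jet]
  have hp₀ : (x₀, f x₀) ∈ φ.source := hbase ▸ hqr.1
  have hev : ∀ᶠ x in 𝓝 x₀, jet (n + 1) f x ∈ regularJets φ n ∧ x ∈ I :=
    ((continuousAt_jet hf.isOpen hf.contDiffOn hxI).eventually
      ((isOpen_regularJets hφ.smooth n).mem_nhds (by rwa [hfq]))).and (hf.isOpen.mem_nhds hxI)
  obtain ⟨δ, hδ, hball⟩ := Metric.eventually_nhds_iff_ball.1 hev
  set I₀ := Metric.ball x₀ δ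
  have hI₀ : IsOpen I₀ := Metric.isOpen_ball
  have hxI₀ : x₀ ∈ I₀ := Metric.mem_ball_self hδ
  have hfI₀ : ContDiffOn ℝ (n + 1 : ℕ) f I₀ := hf.contDiffOn.mono fun x hx => (hball x hx).2
  have hsrc : ∀ x ∈ I₀, (x, f x) ∈ φ.source := fun x hx => by
    have := (hball x hx).1.1
    rwa [base_jet] at this
  obtain ⟨-, hK, -, g, hg, hgφ⟩ := exists_graph_chart hφ.smooth hI₀
    ((convex_ball x₀ δ).isConnected ⟨x₀, hxI₀⟩) hfI₀ fun x hx => (hball x hx).1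
  have hpf := (prolong_jet_eq hφ.smooth hφ.smooth_symm hI₀ hK hfI₀ hg
    (fun x hx => ⟨hsrc x hx, mem_image_of_mem _ hx, (hgφ x hx).symm⟩) hxI₀).2
  rw [hfq, prolong_eq_consJet, jet_succ_eq_consJet, consJet_inj] at hpf
  obtain ⟨N, hN, hflow⟩ := hφ.eventually_flow hΦ hv hp₀
  obtain ⟨I', -, -, -, hxI', hsol⟩ := hsymm I f hf x₀ hxI
  filter_upwards [hflow, hsol] with ε hflow ⟨hdom, I₁, f₁, hgraph, hf₁⟩
  have hmem : Φ ε (x₀, f x₀) ∈ graphOn f₁ I₁ :=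
    hgraph ▸ mem_image_of_mem _ (mem_image_of_mem _ hxI')
  obtain ⟨x₁, hx₁, hx₁e⟩ := hmem
  simp only at hx₁e
  have hneg := hΦ.map_neg ε _ (hdom _ (mem_image_of_mem _ hxI'))
  -- Continuity of the backward flow along the new graph ensures that points near `x₁` come from
  -- points of the old graph in `N` and over `I₀`, where the translation formula and `g` are
  -- available.
  have hc : ContinuousAt (fun t => Φ (-ε) (t, f₁ t)) x₁ := by
    have hf₁c : ContinuousAt f₁ x₁ :=
      hf₁.contDiffOn.continuousOn.continuousAt (hf₁.isOpen.mem_nhds hx₁)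
    have h1 : ContinuousAt (fun z : ℝ × (ℝ × ℝ) => Φ z.1 z.2) (-ε, (x₁, f₁ x₁)) :=
      hΦ.smooth.continuousOn.continuousAt (hΦ.isOpen_dom.mem_nhds (by rw [hx₁e]; exact hneg.1))
    exact h1.comp (f := fun t => (-ε, (t, f₁ t)))
      (continuousAt_const.prodMk (continuousAt_id.prodMk hf₁c))
  have hN' : ∀ᶠ p in 𝓝 (x₀, f x₀), p ∈ N ∧ p.1 ∈ I₀ :=
    Filter.Eventually.and hN (continuousAt_fst.eventually (hI₀.mem_nhds hxI₀))
  have hev₁ : ∀ᶠ t in 𝓝 x₁, t ∈ I₁ ∧ Φ (-ε) (t, f₁ t) ∈ N ∧ (Φ (-ε) (t, f₁ t)).1 ∈ I₀ := by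
    refine Filter.Eventually.and (hf₁.isOpen.mem_nhds hx₁)
      (hc.eventually (p := fun p => p ∈ N ∧ p.1 ∈ I₀) ?_)
    simpa only [hx₁e, hneg.2] using hN'
  obtain ⟨I₂, hI₂sub, hI₂, hx₁I₂⟩ := eventually_nhds_iff.1 hev₁
  have hcurve : ∀ t ∈ I₂, ∃ x ∈ I₀, (t, f₁ t) ∈ φ.source ∧
      φ (t, f₁ t) = φ (x, f x) + (0, ε) := by
    intro t ht
    obtain ⟨ht₁, htN, htI⟩ := hI₂sub t ht
    have : (t, f₁ t) ∈ Φ ε '' graphOn f I' := hgraph ▸ mem_image_of_mem _ ht₁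
    obtain ⟨_, ⟨x, hx, rfl⟩, hxe⟩ := this
    rw [← hxe, (hΦ.map_neg ε _ (hdom _ (mem_image_of_mem _ hx))).2] at htN htI
    obtain ⟨-, h1, h2⟩ := hflow _ htN
    rw [← hxe]
    exact ⟨x, htI, h1, h2⟩
  have hp₁ := prolong_jet_eq hφ.smooth hφ.smooth_symm (g := fun r => g r + ε) hI₂ hK
    (hf₁.contDiffOn.mono fun t ht => (hI₂sub t ht).1) (hg.add contDiffOn_const)
    (fun t ht => by
      obtain ⟨x, hx, h1, h2⟩ := hcurve t ht
      rw [h2]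
      refine ⟨h1, ⟨x, hx, by simp⟩, ?_⟩
      simp [hgφ x hx]) hx₁I₂
  refine ⟨_, hf₁.mem x₁ hx₁, hp₁.1, hf₁.eq_zero x₁ hx₁, hp₁.2.trans ?_⟩
  have hφ₁ : (φ (x₁, f₁ x₁)).1 = (φ (x₀, f x₀)).1 := by
    rw [hx₁e, (hflow _ (mem_of_mem_nhds hN)).2.2]
    simp
  rw [jet_succ_eq_consJet, hφ₁, hpf.1, hpf.2]
  simp

theorem IsReductionDomain.eq_zero_of_eq_zero {M : Set (ℝ × ℝ)} {dom : Set (ℝ × (ℝ × ℝ))}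
    {Φ : ℝ → ℝ × ℝ → ℝ × ℝ} (hΦ : IsLocalOneParameterGroup M dom Φ)
    {v : ℝ × ℝ → ℝ × ℝ} (hv : IsGenerator M Φ v) {n : ℕ} {Ω : Set (Jet (n + 1))}
    {E : Jet (n + 1) → ℝ} (hE : IsODE (n + 1) Ω E) (hsymm : IsSymmetryGroup (n + 1) Ω E dom Φ)
    {φ : OpenPartialHomeomorph (ℝ × ℝ) (ℝ × ℝ)} (hφ : IsRectifyingChart M v φ)
    {D : Set (Jet n)} {J : Set ℝ} (hD : IsReductionDomain Ω v φ D J) {w : Jet n} (hw : w ∈ D)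
    {s s' : ℝ} (hs : s ∈ J) (hs' : s' ∈ J) (h : E (prolong φ.symm (consJet s w)) = 0) :
    E (prolong φ.symm (consJet s' w)) = 0 := by
  set u : Set ℝ := {t | t ∈ J ∧ E (prolong φ.symm (consJet t w)) = 0}
  have hcont : ∀ t ∈ J, ContinuousAt (fun t => E (prolong φ.symm (consJet t w))) t := by
    intro t ht
    obtain ⟨h1, h2⟩ := hD.mem hφ hw ht
    have c1 : ContinuousAt E (prolong φ.symm (consJet t w)) :=
      hE.smooth.continuousOn.continuousAt (hE.isOpen.mem_nhds h2)
    have c2 := (contDiffAt_prolong (φ := φ.symm) hφ.smooth_symm h1).continuousAt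
    have c3 : ContinuousAt (fun t => consJet t w) t :=
      (contDiff_consJet.continuous.comp (Continuous.prodMk_left w)).continuousAt
    exact (c1.comp c2).comp (f := fun t => consJet t w) c3
  have huo : IsOpen u := by
    rw [isOpen_iff_mem_nhds]
    rintro t ⟨ht, h0⟩
    obtain ⟨h1, h2⟩ := hD.mem hφ hw ht
    obtain ⟨h3, h4⟩ := prolong_prolong_symm hφ.smooth hφ.smooth_symm h1
    rw [prolong_eq_consJet φ, consJet_inj] at h4
    have hev := hsymm.eventually_translate hΦ hv hE hφ h2 h3 h0
    rw [h4.1, h4.2] at hev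
    have hsub : Tendsto (fun t' : ℝ => t' - t) (𝓝 t) (𝓝 0) := by
      have : ContinuousAt (fun t' : ℝ => t' - t) t := by fun_prop
      simpa [ContinuousAt] using this
    filter_upwards [hsub.eventually hev, hD.isOpen_interval.mem_nhds ht]
      with t' ⟨q, _, hqr, hq0, hqc⟩ ht'
    refine ⟨ht', ?_⟩
    rw [add_sub_cancel] at hqc
    rw [← hqc, (prolong_symm_prolong hφ.smooth hφ.smooth_symm hqr).2]
    exact hq0
  -- `u` is open by local translation invariance and closed in `J` by continuity of `E`, so it
  -- exhausts the connected set `J`.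
  refine (hD.isConnected.isPreconnected.subset_of_closure_inter_subset huo ⟨s, hs, hs, h⟩
    ?_ hs').2
  rintro t ⟨htu, htJ⟩
  refine ⟨htJ, ?_⟩
  by_contra hne
  obtain ⟨t', h1, h2⟩ := mem_closure_iff_nhds.1 htu _ ((hcont t htJ).eventually_ne hne)
  exact h1 h2.2

/-! ### The reduced equation -/

/-- The direction of the highest derivative in the jet space. -/
def topDirection (k : ℕ) : Jet k := (0, Pi.single (Fin.last k) 1)

theorem consJet_add_topDirection {n : ℕ} (s t : ℝ) (w : Jet n) :
    consJet s (w + t • topDirection n) = consJet s w + t • topDirection (n + 1) := by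
  refine Prod.ext (by simp [consJet, topDirection]) (funext fun i => ?_)
  refine Fin.cases ?_ (fun j => ?_) i
  · simp [consJet, topDirection]
  · by_cases hj : j = Fin.last n
    · subst hj
      simp [consJet, topDirection, ← Fin.succ_last]
    · simp [consJet, topDirection, ← Fin.succ_last, hj]

theorem restrict_add_topDirection {m k : ℕ} (h : k + 1 ≤ m + 1) (hk : k < m) (c : Jet m) (t : ℝ) :
    (c + t • topDirection m).restrict h = c.restrict h := by
  refine Prod.ext (by simp [Jet.restrict, topDirection]) (funext fun i => ?_)
  have hi : Fin.castLE h i ≠ Fin.last m := fun he => by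
    have := congrArg Fin.val he
    simp only [Fin.val_castLE, Fin.val_last] at this
    omega
  simp [Jet.restrict, topDirection, hi]

theorem base_add_topDirection {n : ℕ} (c : Jet (n + 1)) (t : ℝ) :
    (c + t • topDirection (n + 1)).base = c.base := by
  have h := restrict_add_topDirection (k := 0) (by omega) (Nat.succ_pos n) c t
  exact congrArg (Jet.base (k := 0)) h

theorem hasDerivAt_add_smul {F : Type*} [NormedAddCommGroup F] [NormedSpace ℝ F] (c e : F) :
    HasDerivAt (fun t : ℝ => c + t • e) e 0 := by
  simpa using ((hasDerivAt_id (0 : ℝ)).smul_const e).const_add c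

theorem hasDerivAt_comp_add_smul {F G : Type*} [NormedAddCommGroup F] [NormedSpace ℝ F]
    [NormedAddCommGroup G] [NormedSpace ℝ G] {H : F → G} {c : F} (hH : DifferentiableAt ℝ H c)
    (e : F) : HasDerivAt (fun t : ℝ => H (c + t • e)) (fderiv ℝ H c e) 0 := by
  have hH' : HasFDerivAt H (fderiv ℝ H c) (c + (0 : ℝ) • e) := by simpa using hH.hasFDerivAt
  exact hH'.comp_hasDerivAt (0 : ℝ) (hasDerivAt_add_smul c e)

/-- All components of the prolongation but the last ignore the top derivative, so the image is a
multiple of the top direction. The factor is nonzero because the prolongation has a differentiable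
left inverse. -/
theorem fderiv_prolong_topDirection {φ : OpenPartialHomeomorph (ℝ × ℝ) (ℝ × ℝ)}
    (hφ : ContDiffOn ℝ ∞ φ φ.source) (hφ' : ContDiffOn ℝ ∞ φ.symm φ.target) {n : ℕ}
    {c : Jet (n + 1)} (hc : c ∈ regularJets φ n) :
    ∃ κ : ℝ, κ ≠ 0 ∧ fderiv ℝ (prolong φ) c (topDirection (n + 1)) =
      κ • topDirection (n + 1) := by
  have hd := (contDiffAt_prolong hφ hc).differentiableAt (by simp)
  set u := fderiv ℝ (prolong φ) c (topDirection (n + 1)) with hu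
  have h1 : HasDerivAt (fun t : ℝ => prolong φ (c + t • topDirection (n + 1))) u 0 :=
    hasDerivAt_comp_add_smul hd _
  have hfst : u.1 = 0 := by
    have h2 := (ContinuousLinearMap.fst ℝ ℝ (Fin (n + 1 + 1) → ℝ)).hasFDerivAt.comp_hasDerivAt
      (0 : ℝ) h1
    refine h2.unique ((hasDerivAt_const (0 : ℝ) (φ c.base).1).congr_of_eventuallyEq
      (Filter.Eventually.of_forall fun t => ?_))
    simp [prolong, base_add_topDirection]
  have hsnd : ∀ i : Fin (n + 1), u.2 i.castSucc = 0 := by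
    intro i
    have h2 := ((ContinuousLinearMap.proj i.castSucc).comp
      (ContinuousLinearMap.snd ℝ ℝ (Fin (n + 1 + 1) → ℝ))).hasFDerivAt.comp_hasDerivAt (0 : ℝ) h1
    refine h2.unique ((hasDerivAt_const (0 : ℝ) ((prolong φ c).2 i.castSucc)).congr_of_eventuallyEq
      (Filter.Eventually.of_forall fun t => ?_))
    exact congrArg (sDeriv φ (i.castSucc : ℕ)) (restrict_add_topDirection _ i.2 c t)
  have huκ : u = u.2 (Fin.last (n + 1)) • topDirection (n + 1) := by
    refine Prod.ext (by simp [hfst, topDirection]) (funext fun i => ?_)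
    refine Fin.lastCases ?_ (fun j => ?_) i
    · simp [topDirection]
    · simp [topDirection, hsnd j, Fin.castSucc_ne_last]
  refine ⟨_, fun h0 => ?_, huκ⟩
  rw [h0, zero_smul] at huκ
  have hq := (prolong_symm_prolong hφ hφ' hc).1
  have h3 := ((contDiffAt_prolong (φ := φ.symm) hφ' hq).differentiableAt
    (by simp)).hasFDerivAt.comp c hd.hasFDerivAt
  have h4 : HasFDerivAt (prolong φ.symm ∘ prolong φ) (ContinuousLinearMap.id ℝ (Jet (n + 1))) c :=
    (hasFDerivAt_id c).congr_of_eventuallyEq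
      (Filter.eventually_of_mem ((isOpen_regularJets hφ n).mem_nhds hc)
        fun c' hc' => (prolong_symm_prolong hφ hφ' hc').2)
  have h5 : fderiv ℝ (prolong φ.symm) (prolong φ c)
      (fderiv ℝ (prolong φ) c (topDirection (n + 1))) = topDirection (n + 1) :=
    congrArg (fun L : Jet (n + 1) →L[ℝ] Jet (n + 1) => L (topDirection (n + 1))) (h3.unique h4)
  rw [← hu, huκ, map_zero] at h5
  have h6 := congrArg (fun p : Jet (n + 1) => p.2 (Fin.last (n + 1))) h5
  simp [topDirection] at h6

/-- The equation `E = 0` in the coordinates `φ = (r, s)`, at a fixed value of `s`. -/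
noncomputable def reducedEquation {n : ℕ} (φ : OpenPartialHomeomorph (ℝ × ℝ) (ℝ × ℝ))
    (E : Jet (n + 1) → ℝ) (s : ℝ) (w : Jet n) : ℝ :=
  E (prolong φ.symm (consJet s w))

/-- By the chain rule, `∂R/∂z_n = κ · ∂E/∂y_{n+1}` with `κ ≠ 0` from `fderiv_prolong_topDirection`.
-/
theorem IsReductionDomain.isODE_reducedEquation {M : Set (ℝ × ℝ)} {v : ℝ × ℝ → ℝ × ℝ}
    {φ : OpenPartialHomeomorph (ℝ × ℝ) (ℝ × ℝ)} (hφ : IsRectifyingChart M v φ) {n : ℕ}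
    {Ω : Set (Jet (n + 1))} {E : Jet (n + 1) → ℝ} (hE : IsODE (n + 1) Ω E) {D : Set (Jet n)}
    {J : Set ℝ} (hD : IsReductionDomain Ω v φ D J) {s : ℝ} (hs : s ∈ J) :
    IsODE n D (reducedEquation φ E s) := by
  have hEAt : ∀ q ∈ Ω, ContDiffAt ℝ ∞ E q := fun q hq =>
    hE.smooth.contDiffAt (hE.isOpen.mem_nhds hq)
  have hR : ∀ w ∈ D, ContDiffAt ℝ ∞ (reducedEquation φ E s) w := by
    intro w hw
    obtain ⟨h1, h2⟩ := hD.mem hφ hw hs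
    have c3 : ContDiffAt ℝ ∞ (fun w : Jet n => consJet s w) w :=
      (contDiff_consJet.comp (contDiff_prodMk_right s)).contDiffAt
    exact (hEAt _ h2).comp w
      ((contDiffAt_prolong (φ := φ.symm) hφ.smooth_symm h1).comp w c3)
  refine ⟨hD.isOpen, fun w hw => (hR w hw).contDiffWithinAt, fun w hw h0 => ?_⟩
  obtain ⟨h1, h2⟩ := hD.mem hφ hw hs
  obtain ⟨κ, hκ, hκe⟩ := fderiv_prolong_topDirection (φ := φ.symm) hφ.smooth_symm
    (by simpa using hφ.smooth) h1
  have d1 := hasDerivAt_comp_add_smul ((hR w hw).differentiableAt (by simp)) (topDirection n)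
  have d2 := hasDerivAt_comp_add_smul
    ((contDiffAt_prolong (φ := φ.symm) hφ.smooth_symm h1).differentiableAt (by simp))
    (topDirection (n + 1))
  have d3 : HasFDerivAt E (fderiv ℝ E (prolong φ.symm (consJet s w)))
      (prolong φ.symm (consJet s w + (0 : ℝ) • topDirection (n + 1))) := by
    simpa using ((hEAt _ h2).differentiableAt (by simp)).hasFDerivAt
  have d4 := d3.comp_hasDerivAt (0 : ℝ) d2
  rw [hκe, map_smul] at d4
  have d5 := d4.congr_of_eventuallyEq (f₁ := fun t : ℝ =>
    reducedEquation φ E s (w + t • topDirection n)) (Filter.Eventually.of_forall fun t => by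
      simp [reducedEquation, consJet_add_topDirection])
  have d6 := d1.unique d5
  change fderiv ℝ (reducedEquation φ E s) w (topDirection n) ≠ 0
  rw [d6]
  exact smul_ne_zero hκ (hE.regular _ h2 h0)

theorem IsReductionDomain.eq_zero_iff_reducedEquation {M : Set (ℝ × ℝ)}
    {dom : Set (ℝ × (ℝ × ℝ))} {Φ : ℝ → ℝ × ℝ → ℝ × ℝ} (hΦ : IsLocalOneParameterGroup M dom Φ)
    {v : ℝ × ℝ → ℝ × ℝ} (hv : IsGenerator M Φ v) {n : ℕ} {Ω : Set (Jet (n + 1))}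
    {E : Jet (n + 1) → ℝ} (hE : IsODE (n + 1) Ω E) (hsymm : IsSymmetryGroup (n + 1) Ω E dom Φ)
    {φ : OpenPartialHomeomorph (ℝ × ℝ) (ℝ × ℝ)} (hφ : IsRectifyingChart M v φ)
    {D : Set (Jet n)} {J : Set ℝ} (hD : IsReductionDomain Ω v φ D J) {s : ℝ} (hs : s ∈ J)
    {q : Jet (n + 1)} (hq : q ∈ regularJets φ n) (hqJ : (φ q.base).2 ∈ J)
    (hqD : reducedJet φ q ∈ D) : E q = 0 ↔ reducedEquation φ E s (reducedJet φ q) = 0 := by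
  have h1 := (prolong_symm_prolong hφ.smooth hφ.smooth_symm hq).2
  rw [prolong_eq_consJet φ] at h1
  have h2 : E q = 0 ↔ E (prolong φ.symm (consJet (φ q.base).2 (reducedJet φ q))) = 0 := by
    rw [h1]
  rw [h2]
  exact ⟨hD.eq_zero_of_eq_zero hΦ hv hE hsymm hφ hqD hqJ hs,
    hD.eq_zero_of_eq_zero hΦ hv hE hsymm hφ hqD hs hqJ⟩

/-! ### Quadrature -/

theorem hasDerivAt_add_integral {K : Set ℝ} (hK : IsOpen K) (hK' : IsPreconnected K) {θ : ℝ → ℝ}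
    (hθ : ContinuousOn θ K) {r₁ : ℝ} (hr₁ : r₁ ∈ K) (c : ℝ) {r : ℝ} (hr : r ∈ K) :
    HasDerivAt (fun r => c + ∫ t in r₁..r, θ t) (θ r) r := by
  have hsub : uIcc r₁ r ⊆ K := hK'.ordConnected.uIcc_subset hr₁ hr
  exact (intervalIntegral.integral_hasDerivAt_right (hθ.mono hsub).intervalIntegrable
    (hθ.stronglyMeasurableAtFilter hK r hr) (hθ.continuousAt (hK.mem_nhds hr))).const_add c

theorem contDiffOn_succ_of_hasDerivAt {K : Set ℝ} (hK : IsOpen K) {n : ℕ} {σ θ : ℝ → ℝ}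
    (hθ : ContDiffOn ℝ n θ K) (hσ : ∀ r ∈ K, HasDerivAt σ (θ r) r) :
    ContDiffOn ℝ (n + 1 : ℕ) σ K := by
  rw [Nat.cast_succ, contDiffOn_succ_iff_deriv_of_isOpen hK]
  exact ⟨fun r hr => (hσ r hr).differentiableAt.differentiableWithinAt, by simp,
    hθ.congr fun r hr => (hσ r hr).deriv⟩

theorem graphOn_eq_symm_image {φ : OpenPartialHomeomorph (ℝ × ℝ) (ℝ × ℝ)} {f σ : ℝ → ℝ}
    {I : Set ℝ} (hsrc : ∀ x ∈ I, (x, f x) ∈ φ.source)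
    (hσ : ∀ x ∈ I, σ (φ (x, f x)).1 = (φ (x, f x)).2) :
    graphOn f I = φ.symm '' graphOn σ ((fun x => (φ (x, f x)).1) '' I) := by
  simp only [graphOn, image_image]
  refine image_congr fun x hx => ?_
  rw [hσ x hx, Prod.mk.eta, φ.left_inv (hsrc x hx)]

/-- With the graph written `s = g(r)`, take `θ = g'`. The quadrature is the fundamental theorem of
calculus: both sides have derivative `θ` and agree at `r = ρ(x₁)`. -/
theorem exists_reduced_solution {n : ℕ} {M : Set (ℝ × ℝ)} {v : ℝ × ℝ → ℝ × ℝ}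
    {φ : OpenPartialHomeomorph (ℝ × ℝ) (ℝ × ℝ)} (hφ : IsRectifyingChart M v φ)
    {I : Set ℝ} {f : ℝ → ℝ} (hI : IsOpen I) (hI' : IsConnected I)
    (hf : ContDiffOn ℝ (n + 1 : ℕ) f I) (hreg : ∀ x ∈ I, jet (n + 1) f x ∈ regularJets φ n) :
    ∃ θ : ℝ → ℝ,
      ContDiffOn ℝ n θ ((fun x => (φ (x, f x)).1) '' I) ∧
      (∀ x ∈ I, jet n θ (φ (x, f x)).1 = reducedJet φ (jet (n + 1) f x)) ∧
      ∀ x₁ ∈ I, graphOn f I =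
        φ.symm '' graphOn (fun r => (φ (x₁, f x₁)).2 + ∫ t in (φ (x₁, f x₁)).1..r, θ t)
          ((fun x => (φ (x, f x)).1) '' I) := by
  have hsrc : ∀ x ∈ I, (x, f x) ∈ φ.source := fun x hx => by
    have := (hreg x hx).1
    rwa [base_jet] at this
  obtain ⟨-, hK, hK', g, hg, hgφ⟩ := exists_graph_chart hφ.smooth hI hI' hf hreg
  have hg' := hg
  rw [Nat.cast_succ, contDiffOn_succ_iff_deriv_of_isOpen hK] at hg'
  refine ⟨deriv g, hg'.2.2, fun x hx => ?_, fun x₁ hx₁ => ?_⟩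
  · have h1 := (prolong_jet_eq hφ.smooth hφ.smooth_symm hI hK hf hg
      (fun x hx => ⟨hsrc x hx, mem_image_of_mem _ hx, (hgφ x hx).symm⟩) hx).2
    rw [prolong_eq_consJet, jet_succ_eq_consJet n g, consJet_inj] at h1
    exact h1.2.symm
  · refine graphOn_eq_symm_image hsrc fun x hx => ?_
    have hd : ∀ r ∈ (fun x => (φ (x, f x)).1) '' I, HasDerivAt g (deriv g r) r := fun r hr =>
      (hg'.1.differentiableAt (hK.mem_nhds hr)).hasDerivAt
    have he := eqOn_of_hasDerivAt_eq hK hK'.isPreconnected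
      (fun r hr => hasDerivAt_add_integral hK hK'.isPreconnected hg'.2.2.continuousOn
        (mem_image_of_mem _ hx₁) (φ (x₁, f x₁)).2 hr) hd (mem_image_of_mem _ hx₁)
      (by simpa using (hgφ x₁ hx₁).symm)
    exact (he (mem_image_of_mem _ hx)).trans (hgφ x hx)

/-- The primitive `σ` has jets `(r, σ, θ, …)` over `D` and `J`, so they correspond to regular jets
in `Ω`. Hence the curve is a graph over `x`, and the equivalence `hER` turns `R = 0` into `E = 0`.
-/
theorem exists_solution_of_reduced {n : ℕ} {M : Set (ℝ × ℝ)} {v : ℝ × ℝ → ℝ × ℝ}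
    {φ : OpenPartialHomeomorph (ℝ × ℝ) (ℝ × ℝ)} (hφ : IsRectifyingChart M v φ)
    {Ω : Set (Jet (n + 1))} {E : Jet (n + 1) → ℝ} {D : Set (Jet n)} {J : Set ℝ}
    (hD : IsReductionDomain Ω v φ D J) {R : Jet n → ℝ}
    (hER : ∀ q ∈ Ω, q ∈ regularJets φ n → (φ q.base).2 ∈ J → reducedJet φ q ∈ D →
      (E q = 0 ↔ R (reducedJet φ q) = 0))
    {K : Set ℝ} {θ : ℝ → ℝ} (hθ : IsSolution n D R K θ) {r₁ : ℝ} (hr₁ : r₁ ∈ K) (c : ℝ)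
    (hJ : ∀ r ∈ K, c + ∫ t in r₁..r, θ t ∈ J) :
    (∀ r ∈ K, (r, c + ∫ t in r₁..r, θ t) ∈ φ.target) ∧
      ∃ (I : Set ℝ) (f : ℝ → ℝ), IsSolution (n + 1) Ω E I f ∧ NowhereTangent v I f ∧
        graphOn f I = φ.symm '' graphOn (fun r => c + ∫ t in r₁..r, θ t) K := by
  set σ : ℝ → ℝ := fun r => c + ∫ t in r₁..r, θ t
  have hσ : ∀ r ∈ K, HasDerivAt σ (θ r) r := fun r hr =>
    hasDerivAt_add_integral hθ.isOpen hθ.isConnected.isPreconnected hθ.contDiffOn.continuousOn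
      hr₁ c hr
  have hσc := contDiffOn_succ_of_hasDerivAt hθ.isOpen hθ.contDiffOn hσ
  have hjet : ∀ r ∈ K, jet (n + 1) σ r = consJet (σ r) (jet n θ r) := fun r hr => by
    rw [jet_succ_eq_consJet, jet_congr_of_eqOn hθ.isOpen (fun r hr => (hσ r hr).deriv) n hr]
  have hmem : ∀ r ∈ K, jet (n + 1) σ r ∈ regularJets φ.symm n ∧
      prolong φ.symm (jet (n + 1) σ r) ∈ Ω := fun r hr => by
    rw [hjet r hr]
    exact hD.mem hφ (hθ.mem r hr) (hJ r hr)
  have htgt : ∀ r ∈ K, (r, σ r) ∈ φ.target := fun r hr => by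
    have := (hmem r hr).1.1
    rwa [base_jet] at this
  refine ⟨htgt, ?_⟩
  obtain ⟨-, hI, hI', f, hf, hfσ⟩ := exists_graph_chart (φ := φ.symm) hφ.smooth_symm hθ.isOpen
    hθ.isConnected hσc fun r hr => (hmem r hr).1
  have hfjet : ∀ r ∈ K, prolong φ.symm (jet (n + 1) σ r) =
      jet (n + 1) f (φ.symm (r, σ r)).1 := fun r hr =>
    (prolong_jet_eq (φ := φ.symm) hφ.smooth_symm (by simpa using hφ.smooth) hθ.isOpen hI hσc hf
      (fun r hr => ⟨htgt r hr, mem_image_of_mem _ hr, (hfσ r hr).symm⟩) hr).2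
  have hback : ∀ r ∈ K, jet (n + 1) f (φ.symm (r, σ r)).1 ∈ regularJets φ n ∧
      prolong φ (jet (n + 1) f (φ.symm (r, σ r)).1) = consJet (σ r) (jet n θ r) := fun r hr => by
    rw [← hfjet r hr, ← hjet r hr]
    exact prolong_prolong_symm hφ.smooth hφ.smooth_symm (hmem r hr).1
  refine ⟨_, f, ⟨hI, hI', hf, ?_, ?_⟩, (nowhereTangent_iff n).2 ?_, ?_⟩
  · rintro _ ⟨r, hr, rfl⟩
    exact hfjet r hr ▸ (hmem r hr).2
  · rintro _ ⟨r, hr, rfl⟩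
    obtain ⟨h1, h2⟩ := hback r hr
    rw [prolong_eq_consJet, consJet_inj] at h2
    refine (hER _ (hfjet r hr ▸ (hmem r hr).2) h1 ?_ ?_).2 ?_
    · rw [h2.1]
      exact hJ r hr
    · rw [h2.2]
      exact hθ.mem r hr
    · rw [h2.2]
      exact hθ.eq_zero r hr
  · rintro _ ⟨r, hr, rfl⟩
    exact (hφ.mem_regularJets_iff.1 (hback r hr).1).2
  · simp only [graphOn, image_image]
    exact image_congr fun r hr => Prod.ext rfl (hfσ r hr)

end ODEReduction

theorem mainTheorem1 (n : ℕ)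
    (M : Set (ℝ × ℝ)) (dom : Set (ℝ × (ℝ × ℝ))) (Φ : ℝ → ℝ × ℝ → ℝ × ℝ)
    (hΦ : IsLocalOneParameterGroup M dom Φ)
    (v : ℝ × ℝ → ℝ × ℝ) (hv : IsGenerator M Φ v)
    (Ω : Set (Jet (n + 1))) (hΩM : ∀ q ∈ Ω, q.base ∈ M)
    (E : Jet (n + 1) → ℝ) (hE : IsODE (n + 1) Ω E)
    (hsymm : IsSymmetryGroup (n + 1) Ω E dom Φ) :
    -- rectifying coordinates exist near every point where `v` does not vanish
    (∀ p ∈ M, v p ≠ 0 →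
      ∃ φ : OpenPartialHomeomorph (ℝ × ℝ) (ℝ × ℝ), IsRectifyingChart M v φ ∧ p ∈ φ.source) ∧
    ∀ φ : OpenPartialHomeomorph (ℝ × ℝ) (ℝ × ℝ), IsRectifyingChart M v φ →
      -- the reduction domains cover the jets that are transverse to `v`
      (∀ q ∈ Ω, q.base ∈ φ.source → Transverse v q →
        ∃ (D : Set (Jet n)) (J : Set ℝ), IsReductionDomain Ω v φ D J ∧
          reducedJet φ q ∈ D ∧ (φ q.base).2 ∈ J) ∧
      ∀ (D : Set (Jet n)) (J : Set ℝ), IsReductionDomain Ω v φ D J →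
        -- the reduced equation `R(r, z, …, z_n) = 0`, of order `n`
        ∃ R : Jet n → ℝ, IsODE n D R ∧
          -- it is the given equation, which does not involve `s` in the coordinates `(r, s)`
          (∀ q ∈ Ω, q.base ∈ φ.source → Transverse v q → (φ q.base).2 ∈ J →
            reducedJet φ q ∈ D → (E q = 0 ↔ R (reducedJet φ q) = 0)) ∧
          -- every nontangential solution is obtained by one quadrature from a solution `θ` of it
          (∀ (I : Set ℝ) (f : ℝ → ℝ), IsSolution (n + 1) Ω E I f → NowhereTangent v I f →
            (∀ x ∈ I, (x, f x) ∈ φ.source) →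
            ∃ θ : ℝ → ℝ,
              InjOn (fun x => (φ (x, f x)).1) I ∧
              ContDiffOn ℝ n θ ((fun x => (φ (x, f x)).1) '' I) ∧
              (∀ x ∈ I, jet n θ (φ (x, f x)).1 = reducedJet φ (jet (n + 1) f x)) ∧
              (∀ I' ⊆ I, IsOpen I' → IsConnected I' →
                (∀ x ∈ I', reducedJet φ (jet (n + 1) f x) ∈ D ∧ (φ (x, f x)).2 ∈ J) →
                IsSolution n D R ((fun x => (φ (x, f x)).1) '' I') θ) ∧
              ∀ x₁ ∈ I, graphOn f I =
                φ.symm '' graphOn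
                  (fun r => (φ (x₁, f x₁)).2 + ∫ t in (φ (x₁, f x₁)).1..r, θ t)
                  ((fun x => (φ (x, f x)).1) '' I)) ∧
          -- conversely, one quadrature of a solution `θ` of it yields a nontangential solution
          (∀ (K : Set ℝ) (θ : ℝ → ℝ), IsSolution n D R K θ → ∀ r₁ ∈ K, ∀ c : ℝ,
            (∀ r ∈ K, c + ∫ t in r₁..r, θ t ∈ J) →
            (∀ r ∈ K, (r, c + ∫ t in r₁..r, θ t) ∈ φ.target) ∧
            ∃ (I : Set ℝ) (f : ℝ → ℝ), IsSolution (n + 1) Ω E I f ∧ NowhereTangent v I f ∧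
              graphOn f I = φ.symm '' graphOn (fun r => c + ∫ t in r₁..r, θ t) K) := by
  refine ⟨fun p hp hvp => exists_rectifyingChart hΦ hv hp hvp, fun φ hφ =>
    ⟨fun q hq hqs hqt => hφ.exists_isReductionDomain hE.isOpen hq
      (hφ.mem_regularJets_iff.2 ⟨hqs, hqt⟩), fun D J hD => ?_⟩⟩
  -- Any value will do: different choices may change `R`, but not its zero set in `D`.
  obtain ⟨s₀, hs₀⟩ := hD.isConnected.nonempty
  have hER : ∀ q ∈ Ω, q ∈ regularJets φ n → (φ q.base).2 ∈ J → reducedJet φ q ∈ D →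
      (E q = 0 ↔ reducedEquation φ E s₀ (reducedJet φ q) = 0) := fun q _ hqr hqJ hqD =>
    hD.eq_zero_iff_reducedEquation hΦ hv hE hsymm hφ hs₀ hqr hqJ hqD
  refine ⟨reducedEquation φ E s₀, hD.isODE_reducedEquation hφ hE hs₀,
    fun q hq hqs hqt hqJ hqD => hER q hq (hφ.mem_regularJets_iff.2 ⟨hqs, hqt⟩) hqJ hqD,
    fun I f hf hft hfs => ?_,
    fun K θ hθ r₁ hr₁ c hJ => exists_solution_of_reduced hφ hD hER hθ hr₁ c hJ⟩
  have hreg : ∀ x ∈ I, jet (n + 1) f x ∈ regularJets φ n := fun x hx =>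
    hφ.mem_regularJets_iff.2 ⟨by rw [base_jet]; exact hfs x hx, (nowhereTangent_iff n).1 hft x hx⟩
  obtain ⟨θ, hθ, hjet, hgraph⟩ :=
    exists_reduced_solution hφ hf.isOpen hf.isConnected hf.contDiffOn hreg
  refine ⟨θ, (exists_graph_chart hφ.smooth hf.isOpen hf.isConnected hf.contDiffOn hreg).1, hθ,
    hjet, fun I' hI'I hI'o hI'c hmem => ?_, hgraph⟩
  -- Only the openness and connectedness of `ρ(I')` are needed here; `θ` is the one already found on
  -- `ρ(I)`.
  obtain ⟨-, hK, hK', -⟩ := exists_graph_chart hφ.smooth hI'o hI'c (hf.contDiffOn.mono hI'I)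
    fun x hx => hreg x (hI'I hx)
  refine ⟨hK, hK', hθ.mono (image_mono hI'I), ?_, ?_⟩
  · rintro _ ⟨x, hx, rfl⟩
    rw [hjet x (hI'I hx)]
    exact (hmem x hx).1
  · rintro _ ⟨x, hx, rfl⟩
    rw [hjet x (hI'I hx)]
    exact (hER _ (hf.mem x (hI'I hx)) (hreg x (hI'I hx)) (by rw [base_jet]; exact (hmem x hx).2)
      (hmem x hx).1).1 (hf.eq_zero x (hI'I hx))
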